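/- Let $H$ be a finite, simple, connected graph with maximum degree $\Delta=\Delta(H)\ge 5$. Assume that $H$ is $(K_\Delta\setminus e)$-free, i.e. $H$ contains no (not necessarily induced) subgraph isomorphic to the graph obtained from the complete graph $K_\Delta$ by deleting one edge. Let $p,q\ge 2$ be integers with $p+q=\Delta+1$. Then $V(H)$ can be partitioned into two disjoint sets $V_1,V_2$ (possibly empty), $V_1\cup V_2=V(H)$, such that the induced subgraph $H[V_1]$ contains no clique on $p$ vertices, and the induced subgraph $H[V_2]$ either contains no clique on $q$ vertices or has the property that any two distinct $q$-vertex cliques of $H[V_2]$ are vertex-disjoint. -/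

import Mathlib

/-- `H` is `K_n ∖ e`-free: `H` contains no (not necessarily induced) copy of a graph obtained from
the complete graph on `n` vertices by deleting one edge `e`. -/
def CompleteMinusEdgeFree {V : Type*} (n : ℕ) (H : SimpleGraph V) : Prop :=
  ∀ e ∈ (⊤ : SimpleGraph (Fin n)).edgeSet, ((⊤ : SimpleGraph (Fin n)).deleteEdges {e}).Free H

/-- Any two distinct `q`-cliques of `H` are (vertex-)disjoint. -/
def DisjointCliques {V : Type*} (q : ℕ) (H : SimpleGraph V) : Prop :=
  ∀ s t : Finset V, H.IsNClique q s → H.IsNClique q t → s ≠ t → Disjoint s t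

/-!
Write `Δ` for the maximum degree, so `p + q = Δ + 1`. The hypothesis enters only through
`NoAlmostClique`: no `Δ` vertices form a clique up to at most one missing edge.

For `q ≥ 3` the part `S = V₁` is chosen in two steps. Among all sets it minimizes `e(S) + e(Sᶜ) +
(q + 1 - p) * #S`; this bounds the degrees in `S` by `p - 1` and those in `Sᶜ` by `q`, and the
vertices attaining these bounds may change sides at no cost. Among these minimizers `S` minimizes
twice the number of `p`-cliques in `S` plus the number of `q`-cliques in `Sᶜ`. Two `q`-cliques of
`Sᶜ` with a common vertex `v` could then be traded for one `p`-clique in `S` by moving `v`. So it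
is enough that an optimal `S` contains no `p`-clique (`exists_partition_of_three_le`).

Suppose `A ⊆ S` is such a clique, a *token*. By optimality, the neighbours in `Sᶜ` of each `y ∈ A`
form a `q`-clique up to one missing edge (`IsToken.exists_isClique_erase`), and exchanging `y`
with a neighbour `u` that is adjacent to all the others gives an optimal set again, in which `u`
lies in a new token (`IsToken.exchange`). The token can therefore be moved for ever. It cannot
come back to where it was: what remains of a former token has a common neighbour with `q - 1`
neighbours in `Sᶜ`, and such a vertex has at most one neighbour in a token, since otherwise an
almost complete graph on `Δ` vertices appears (`IsToken.not_adj_of_adj`). The number of these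
remains grows with each move (`IsTrail.exists_insert`), which is impossible in a finite graph.
This needs `p ≥ 3`; for `p = 2` a token vertex and its neighbours in `Sᶜ` are already an almost
complete graph on `Δ` vertices.

For `q = 2` the set `V₂` has to meet all cliques on `p = Δ - 1 ≥ 4` vertices and to induce a graph
of maximum degree at most one. Two `p`-cliques that meet share exactly `p - 2` vertices, and no
vertex lies in three of them (`card_inter_of_isNClique`, `eq_or_eq_of_isNClique`). A minimal set
of shared vertices meeting the `p`-cliques that have one induces maximum degree at most one
(`exists_hitting_sharedVertices`). The other `p`-cliques are disjoint, with at most two edges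
leaving them at each vertex, and Haxell's theorem gives them an independent transversal
(`exists_independent_hitting`). There are no edges between the two sets.
-/

open Finset

/-! ### Counting cliques -/

section Counting
variable {V : Type*} [DecidableEq V] (H : SimpleGraph V) [DecidableRel H.Adj]

/-- The neighbours of `v` that lie in `X`. -/
def nbrsIn (X : Finset V) (v : V) : Finset V := X.filter (H.Adj v)

/-- The `m`-cliques contained in `X`. -/
def cliquesIn (m : ℕ) (X : Finset V) : Finset (Finset V) :=
  (X.powersetCard m).filter (fun C => H.IsClique (C : Set V))

variable {H}

omit [DecidableEq V] in
lemma mem_nbrsIn {X : Finset V} {v w : V} : w ∈ nbrsIn H X v ↔ w ∈ X ∧ H.Adj v w := by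
  simp [nbrsIn]

lemma mem_cliquesIn {m : ℕ} {X C : Finset V} :
    C ∈ cliquesIn H m X ↔ C ⊆ X ∧ C.card = m ∧ H.IsClique (C : Set V) := by
  simp [cliquesIn, mem_powersetCard, and_assoc]

lemma cliquesIn_mono {m : ℕ} {X Y : Finset V} (h : X ⊆ Y) :
    cliquesIn H m X ⊆ cliquesIn H m Y := fun C hC => by
  rw [mem_cliquesIn] at hC ⊢; exact ⟨hC.1.trans h, hC.2⟩

lemma nbrsIn_insert_self (X : Finset V) (v : V) : nbrsIn H (insert v X) v = nbrsIn H X v := by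
  ext w; simp only [mem_nbrsIn, mem_insert]
  constructor
  · rintro ⟨rfl | h, h'⟩
    · exact (H.irrefl h').elim
    · exact ⟨h, h'⟩
  · rintro ⟨h, h'⟩; exact ⟨Or.inr h, h'⟩

lemma nbrsIn_erase_self (X : Finset V) (v : V) : nbrsIn H (X.erase v) v = nbrsIn H X v := by
  ext w; simp only [mem_nbrsIn, mem_erase]
  exact ⟨fun h => ⟨h.1.2, h.2⟩, fun h => ⟨⟨h.2.ne', h.1⟩, h.2⟩⟩

lemma isClique_insert_iff_subset_nbrsIn {U C : Finset V} {v : V} (hC : C ⊆ U) (hv : v ∉ U) :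
    H.IsClique ((insert v C : Finset V) : Set V) ↔ H.IsClique (C : Set V) ∧ C ⊆ nbrsIn H U v := by
  rw [coe_insert, SimpleGraph.isClique_insert]
  refine and_congr_right fun _ => ⟨fun h w hw => ?_, fun h w hw _ => ?_⟩
  · exact mem_nbrsIn.2 ⟨hC hw, h w (by simpa using hw) (fun e => hv (e ▸ hC hw))⟩
  · exact (mem_nbrsIn.1 (h (by simpa using hw))).2

/-- The `(m + 1)`-cliques of `U + v` either avoid `v` or arise from an `m`-clique in the
neighbourhood of `v`. -/
lemma card_cliquesIn_insert {m : ℕ} (hm : 0 < m) {U : Finset V} {v : V} (hv : v ∉ U) :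
    (cliquesIn H m (insert v U)).card =
      (cliquesIn H m U).card + (cliquesIn H (m - 1) (nbrsIn H U v)).card := by
  obtain ⟨m, rfl⟩ := Nat.exists_eq_add_of_lt hm
  simp only [zero_add, Nat.add_sub_cancel]
  have h1 : cliquesIn H (m + 1) (insert v U) =
      cliquesIn H (m + 1) U ∪ (cliquesIn H m (nbrsIn H U v)).image (insert v) := by
    have h2 : ((powersetCard m U).image (insert v)).filter
        (fun C : Finset V => H.IsClique (C : Set V)) = 
          (cliquesIn H m (nbrsIn H U v)).image (insert v) := by
      ext D
      simp only [mem_filter, mem_image, mem_cliquesIn, mem_powersetCard]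
      constructor
      · rintro ⟨⟨C, ⟨hC, hm⟩, rfl⟩, hcl⟩
        have := (isClique_insert_iff_subset_nbrsIn hC hv).1 hcl
        exact ⟨C, ⟨this.2, hm, this.1⟩, rfl⟩
      · rintro ⟨C, ⟨hC, hm, hcl⟩, rfl⟩
        have hCU : C ⊆ U := hC.trans (filter_subset _ _)
        exact ⟨⟨C, ⟨hCU, hm⟩, rfl⟩, (isClique_insert_iff_subset_nbrsIn hCU hv).2 ⟨hcl, hC⟩⟩
    unfold cliquesIn at h2 ⊢
    rw [Finset.powersetCard_succ_insert hv, filter_union, h2]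
  have hU : ∀ C ∈ cliquesIn H m (nbrsIn H U v), v ∉ C := fun C hC hvC =>
    hv ((mem_nbrsIn.1 ((mem_cliquesIn.1 hC).1 hvC)).1)
  rw [h1, card_union_of_disjoint, card_image_of_injOn]
  · intro C hC D hD h
    have := congrArg (fun E => E.erase v) h
    simpa [erase_insert (hU C hC), erase_insert (hU D hD)] using this
  · rw [disjoint_left]
    intro C hC hC'
    obtain ⟨D, -, rfl⟩ := mem_image.1 hC'
    exact hv ((mem_cliquesIn.1 hC).1 (mem_insert_self _ _))

lemma card_cliquesIn_erase {m : ℕ} (hm : 0 < m) {X : Finset V} {v : V} (hv : v ∈ X) :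
    (cliquesIn H m X).card =
      (cliquesIn H m (X.erase v)).card + (cliquesIn H (m - 1) (nbrsIn H X v)).card := by
  have := card_cliquesIn_insert (H := H) hm (notMem_erase v X)
  rwa [insert_erase hv, nbrsIn_erase_self] at this

lemma card_cliquesIn_one (X : Finset V) : (cliquesIn H 1 X).card = X.card := by
  have : cliquesIn H 1 X = X.powersetCard 1 := by
    refine filter_true_of_mem fun C hC => ?_
    obtain ⟨a, rfl⟩ := card_eq_one.1 (mem_powersetCard.1 hC).2
    simp
  rw [this, card_powersetCard, Nat.choose_one_right]

lemma cliquesIn_card_subset (X : Finset V) : cliquesIn H X.card X ⊆ {X} := by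
  intro C hC
  obtain ⟨h1, h2, -⟩ := mem_cliquesIn.1 hC
  exact mem_singleton.2 (eq_of_subset_of_card_le h1 h2.ge)

lemma card_cliquesIn_le_one {m : ℕ} {X : Finset V} (h : X.card = m) :
    (cliquesIn H m X).card ≤ 1 := by
  subst h; exact (card_le_card (cliquesIn_card_subset X)).trans (by simp)

lemma card_cliquesIn_eq_zero {m : ℕ} {X : Finset V} (h : X.card = m)
    (hX : ¬ H.IsClique (X : Set V)) : (cliquesIn H m X).card = 0 := by
  subst h
  rw [card_eq_zero, eq_empty_iff_forall_notMem]
  intro C hC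
  have := mem_singleton.1 (cliquesIn_card_subset X hC)
  subst this
  exact hX (mem_cliquesIn.1 hC).2.2

lemma card_nbrsIn_add_compl [Fintype V] (S : Finset V) (v : V) :
    (nbrsIn H S v).card + (nbrsIn H Sᶜ v).card = H.degree v := by
  rw [← H.card_neighborFinset_eq_degree, ← card_union_of_disjoint]
  · congr 1
    ext w
    simp only [mem_union, mem_nbrsIn, mem_compl, SimpleGraph.mem_neighborFinset]
    tauto
  · exact disjoint_left.2 fun w h1 h2 => (mem_compl.1 (mem_nbrsIn.1 h2).1) (mem_nbrsIn.1 h1).1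

end Counting

/-! ### Optimal sets -/

section Optimal
variable {V : Type*} [Fintype V] [DecidableEq V] (H : SimpleGraph V) [DecidableRel H.Adj] (p q : ℕ)

/-- The number of edges inside the two parts `S` and `Sᶜ`, shifted by a multiple of `#S`. -/
def edgeWeight (S : Finset V) : ℤ :=
  (cliquesIn H 2 S).card + (cliquesIn H 2 Sᶜ).card + ((q : ℤ) + 1 - p) * S.card

/-- Twice the number of `p`-cliques in `S` plus the number of `q`-cliques in `Sᶜ`. -/
def cliqueWeight (S : Finset V) : ℕ :=
  2 * (cliquesIn H p S).card + (cliquesIn H q Sᶜ).card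

/-- `S` minimizes the edge weight. -/
def IsEdgeOptimal (S : Finset V) : Prop := ∀ T, edgeWeight H p q S ≤ edgeWeight H p q T

/-- `S` minimizes the clique weight among the sets that minimize the edge weight. -/
def IsOptimal (S : Finset V) : Prop :=
  IsEdgeOptimal H p q S ∧ ∀ T, IsEdgeOptimal H p q T → cliqueWeight H p q S ≤ cliqueWeight H p q T

lemma exists_isOptimal : ∃ S, IsOptimal H p q S := by
  classical
  obtain ⟨S₀, -, h₀⟩ := exists_min_image (univ : Finset (Finset V)) (edgeWeight H p q)
    univ_nonempty
  obtain ⟨S, hS, h⟩ := exists_min_image (univ.filter (IsEdgeOptimal H p q)) (cliqueWeight H p q)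
    ⟨S₀, by simpa [IsEdgeOptimal] using h₀⟩
  exact ⟨S, by simpa using hS, fun T hT => h T (by simpa using hT)⟩

variable {H p q}

lemma edgeWeight_insert {S : Finset V} {v : V} (hv : v ∉ S) :
    edgeWeight H p q (insert v S) =
      edgeWeight H p q S + (nbrsIn H S v).card - (nbrsIn H Sᶜ v).card + (q + 1 - p) := by
  have h1 := card_cliquesIn_insert (H := H) two_pos hv
  have h2 := card_cliquesIn_erase (H := H) two_pos (mem_compl.2 hv)
  rw [show 2 - 1 = 1 from rfl, card_cliquesIn_one] at h1 h2
  unfold edgeWeight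
  rw [compl_insert, h1, h2, card_insert_of_notMem hv]
  push_cast
  ring

lemma edgeWeight_erase {S : Finset V} {v : V} (hv : v ∈ S) :
    edgeWeight H p q (S.erase v) =
      edgeWeight H p q S - (nbrsIn H S v).card + (nbrsIn H Sᶜ v).card - (q + 1 - p) := by
  have h := edgeWeight_insert (H := H) (p := p) (q := q) (notMem_erase v S)
  rw [insert_erase hv, nbrsIn_erase_self, compl_erase, nbrsIn_insert_self] at h
  linarith

variable (hdeg : ∀ v, H.degree v + 1 ≤ p + q) {S : Finset V}
include hdeg

lemma IsEdgeOptimal.card_nbrsIn_compl_eq (hS : IsEdgeOptimal H p q S) {y : V} (hy : y ∈ S)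
    (h : p ≤ (nbrsIn H S y).card + 1) :
    (nbrsIn H S y).card + 1 = p ∧ (nbrsIn H Sᶜ y).card = q := by
  have h1 := hS (S.erase y)
  rw [edgeWeight_erase hy] at h1
  have h2 := card_nbrsIn_add_compl (H := H) S y
  have h3 := hdeg y
  omega

lemma IsEdgeOptimal.card_nbrsIn_eq (hS : IsEdgeOptimal H p q S) {v : V} (hv : v ∉ S)
    (h : q ≤ (nbrsIn H Sᶜ v).card) :
    (nbrsIn H S v).card + 1 = p ∧ (nbrsIn H Sᶜ v).card = q := by
  have h1 := hS (insert v S)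
  rw [edgeWeight_insert hv] at h1
  have h2 := card_nbrsIn_add_compl (H := H) S v
  have h3 := hdeg v
  omega

lemma IsEdgeOptimal.erase (hS : IsEdgeOptimal H p q S) {y : V} (hy : y ∈ S)
    (h : p ≤ (nbrsIn H S y).card + 1) : IsEdgeOptimal H p q (S.erase y) := by
  obtain ⟨h1, h2⟩ := hS.card_nbrsIn_compl_eq hdeg hy h
  intro T
  rw [edgeWeight_erase hy]
  have := hS T
  omega

lemma IsEdgeOptimal.insert (hS : IsEdgeOptimal H p q S) {v : V} (hv : v ∉ S)
    (h : q ≤ (nbrsIn H Sᶜ v).card) : IsEdgeOptimal H p q (insert v S) := by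
  obtain ⟨h1, h2⟩ := hS.card_nbrsIn_eq hdeg hv h
  intro T
  rw [edgeWeight_insert hv]
  have := hS T
  omega

end Optimal

/-! ### Tokens -/

section Token
variable {V : Type*} [DecidableEq V]

/-- No `n`-set of vertices of `H` is a clique up to at most one missing edge. The missing edge is
`ab` exactly when deleting `a` and deleting `b` both leave a clique. -/
def NoAlmostClique (H : SimpleGraph V) (n : ℕ) : Prop :=
  ∀ D : Finset V, D.card = n → ∀ a ∈ D, ∀ b ∈ D, a ≠ b →
    H.IsClique (D.erase a : Finset V) → H.IsClique (D.erase b : Finset V) → False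

lemma NoAlmostClique.not_isClique {H : SimpleGraph V} {n : ℕ} (h : NoAlmostClique H n) (hn : 2 ≤ n)
    {D : Finset V} (hD : D.card = n) : ¬ H.IsClique (D : Set V) := fun hc => by
  obtain ⟨a, ha, b, hb, hab⟩ := one_lt_card.1 (show 1 < D.card by omega)
  exact h D hD a ha b hb hab (hc.subset (coe_subset.2 (erase_subset _ _)))
    (hc.subset (coe_subset.2 (erase_subset _ _)))

/-- If `R - a` and `R - b` are cliques, then a vertex of `R` other than `a`, `b` is adjacent to
all the other vertices of `R`. -/
lemma adj_of_isClique_erase {H : SimpleGraph V} {R : Finset V} {a b u v : V} (hab : a ≠ b)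
    (ha : H.IsClique (R.erase a : Finset V)) (hb : H.IsClique (R.erase b : Finset V))
    (hu : u ∈ R) (hua : u ≠ a) (hub : u ≠ b) (hv : v ∈ R) (huv : u ≠ v) : H.Adj u v := by
  by_cases h : v = a
  · exact hb (by simp [hu, hub]) (by simp [hv, h ▸ hab]) huv
  · exact ha (by simp [hu, hua]) (by simp [hv, h]) huv

lemma isClique_union {H : SimpleGraph V} {A B : Finset V} (hA : H.IsClique (A : Set V))
    (hB : H.IsClique (B : Set V)) (h : ∀ a ∈ A, ∀ b ∈ B, H.Adj a b) :
    H.IsClique ((A ∪ B : Finset V) : Set V) := by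
  intro x hx y hy hxy
  simp only [coe_union, Set.mem_union, mem_coe] at hx hy
  rcases hx with hx | hx <;> rcases hy with hy | hy
  · exact hA hx hy hxy
  · exact h x hx y hy
  · exact (h y hy x hx).symm
  · exact hB hx hy hxy

variable [Fintype V]

lemma nbrsIn_compl_erase {H : SimpleGraph V} [DecidableRel H.Adj] {S : Finset V} {y u : V}
    (hyu : H.Adj y u) : nbrsIn H (S.erase y)ᶜ u = insert y (nbrsIn H Sᶜ u) := by
  rw [compl_erase]
  ext w
  simp only [mem_nbrsIn, mem_insert]
  constructor
  · rintro ⟨rfl | h, h'⟩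
    · exact Or.inl rfl
    · exact Or.inr ⟨h, h'⟩
  · rintro (rfl | ⟨h, h'⟩)
    · exact ⟨Or.inl rfl, hyu.symm⟩
    · exact ⟨Or.inr h, h'⟩

variable (H : SimpleGraph V) [DecidableRel H.Adj] (p q : ℕ)

/-- `A` is a `p`-clique inside the optimal set `S`. -/
structure IsToken (S A : Finset V) : Prop where
  optimal : IsOptimal H p q S
  subset : A ⊆ S
  card : A.card = p
  clique : H.IsClique (A : Set V)

variable {H p q} {S A : Finset V} (hT : IsToken H p q S A) (hdeg : ∀ v, H.degree v + 1 ≤ p + q)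
  (hp : 2 ≤ p) (hq : 2 ≤ q)
include hT hdeg hp hq

omit hp hq in
/-- A token is a connected component of the graph induced on `S`. -/
lemma IsToken.nbrsIn_eq {y : V} (hy : y ∈ A) :
    nbrsIn H S y = A.erase y ∧ (nbrsIn H Sᶜ y).card = q := by
  have h1 : A.erase y ⊆ nbrsIn H S y := fun z hz => by
    rw [mem_erase] at hz
    exact mem_nbrsIn.2 ⟨hT.subset hz.2, hT.clique hy hz.2 hz.1.symm⟩
  have h2 : (A.erase y).card + 1 = p := by rw [card_erase_add_one hy, hT.card]
  have h3 := card_le_card h1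
  obtain ⟨h4, h5⟩ := hT.optimal.1.card_nbrsIn_compl_eq hdeg (hT.subset hy) (by omega)
  exact ⟨(eq_of_subset_of_card_le h1 (by omega)).symm, h5⟩

omit hp hq in
lemma IsToken.isEdgeOptimal_erase {y : V} (hy : y ∈ A) : IsEdgeOptimal H p q (S.erase y) := by
  refine hT.optimal.1.erase hdeg (hT.subset hy) ?_
  rw [(hT.nbrsIn_eq hdeg hy).1, card_erase_add_one hy, hT.card]

omit hq in
lemma IsToken.card_cliquesIn_erase_add_one {y : V} (hy : y ∈ A) :
    (cliquesIn H p (S.erase y)).card + 1 = (cliquesIn H p S).card := by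
  rw [card_cliquesIn_erase (by omega) (hT.subset hy), (hT.nbrsIn_eq hdeg hy).1]
  have hc : (A.erase y).card = p - 1 := by rw [card_erase_of_mem hy, hT.card]
  have h1 := card_cliquesIn_le_one (H := H) hc
  have h2 : 0 < (cliquesIn H (p - 1) (A.erase y)).card :=
    card_pos.2 ⟨A.erase y, mem_cliquesIn.2 ⟨Subset.rfl, hc,
      hT.clique.subset (coe_subset.2 (erase_subset _ _))⟩⟩
  omega

/-- Moving a vertex `y` of a token to `Sᶜ` has to create two `q`-cliques there, so the `q`
neighbours of `y` in `Sᶜ` form a clique up to one missing edge. -/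
lemma IsToken.exists_isClique_erase {y : V} (hy : y ∈ A) :
    ∃ a ∈ nbrsIn H Sᶜ y, ∃ b ∈ nbrsIn H Sᶜ y, a ≠ b ∧
      H.IsClique ((nbrsIn H Sᶜ y).erase a : Finset V) ∧
      H.IsClique ((nbrsIn H Sᶜ y).erase b : Finset V) := by
  have hR := (hT.nbrsIn_eq hdeg hy).2
  have h1 := hT.optimal.2 _ (hT.isEdgeOptimal_erase hdeg hy)
  have h2 := hT.card_cliquesIn_erase_add_one hdeg hp hy
  unfold cliqueWeight at h1
  rw [compl_erase, card_cliquesIn_insert (by omega) (by simpa using hT.subset hy)] at h1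
  obtain ⟨C, hC, D, hD, hCD⟩ := one_lt_card.1
    (show 1 < (cliquesIn H (q - 1) (nbrsIn H Sᶜ y)).card by omega)
  have key : ∀ C ∈ cliquesIn H (q - 1) (nbrsIn H Sᶜ y), ∃ a ∈ nbrsIn H Sᶜ y,
      (nbrsIn H Sᶜ y).erase a = C := by
    intro C hC
    obtain ⟨c1, c2, -⟩ := mem_cliquesIn.1 hC
    obtain ⟨a, ha, ha'⟩ := exists_mem_notMem_of_card_lt_card (show C.card < (nbrsIn H Sᶜ y).card by
      rw [c2, hR]; omega)
    refine ⟨a, ha, (eq_of_subset_of_card_le (fun c hc => mem_erase.2 ⟨?_, c1 hc⟩) ?_).symm⟩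
    · rintro rfl; exact ha' hc
    · rw [card_erase_of_mem ha, hR, c2]
  obtain ⟨a, ha, rfl⟩ := key C hC
  obtain ⟨b, hb, rfl⟩ := key D hD
  exact ⟨a, ha, b, hb, fun h => hCD (by rw [h]), (mem_cliquesIn.1 hC).2.2, (mem_cliquesIn.1 hD).2.2⟩

omit hdeg hp hq in
lemma IsToken.card_nbrsIn_compl_erase {y u : V} (hy : y ∈ A) (hyu : H.Adj y u) :
    (nbrsIn H (S.erase y)ᶜ u).card = (nbrsIn H Sᶜ u).card + 1 := by
  rw [nbrsIn_compl_erase hyu, card_insert_of_notMem]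
  intro h
  exact (mem_compl.1 (mem_nbrsIn.1 h).1) (hT.subset hy)

/-- Let `u ∈ Sᶜ` be a neighbour of a token vertex `y` with `q - 1` neighbours in `Sᶜ`. Exchanging
`y` and `u` keeps the edge weight minimal, destroys a `p`-clique of `S`, and creates at most one
`q`-clique in `Sᶜ`, where `y` retains only `q - 1` neighbours; hence `u` must complete a
`p`-clique. -/
lemma IsToken.isClique_nbrsIn_erase {y u : V} (hy : y ∈ A) (hyu : H.Adj y u) (hu : u ∉ S)
    (hgood : (nbrsIn H Sᶜ u).card + 1 = q) :
    IsEdgeOptimal H p q (insert u (S.erase y)) ∧ (nbrsIn H (S.erase y) u).card + 1 = p ∧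
      H.IsClique (nbrsIn H (S.erase y) u : Set V) := by
  have hE := hT.isEdgeOptimal_erase hdeg hy
  have hu' : u ∉ S.erase y := fun h => hu (mem_of_mem_erase h)
  have hc : q ≤ (nbrsIn H (S.erase y)ᶜ u).card := by
    rw [hT.card_nbrsIn_compl_erase hy hyu]; omega
  have hI := hE.insert hdeg hu' hc
  have hd := (hE.card_nbrsIn_eq hdeg hu' hc).1
  refine ⟨hI, hd, ?_⟩
  by_contra hcl
  have h1 := hT.optimal.2 _ hI
  have h2 := hT.card_cliquesIn_erase_add_one hdeg hp hy
  have hyU : y ∉ Sᶜ.erase u := by simp [hT.subset hy]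
  have hcompl : (insert u (S.erase y))ᶜ = insert y (Sᶜ.erase u) := by
    rw [compl_insert, compl_erase, erase_insert_of_ne hyu.ne]
  have h3 : (nbrsIn H (Sᶜ.erase u) y).card = q - 1 := by
    have : nbrsIn H (Sᶜ.erase u) y = (nbrsIn H Sᶜ y).erase u := by
      ext w; simp only [mem_nbrsIn, mem_erase]; tauto
    rw [this, card_erase_of_mem (mem_nbrsIn.2 ⟨mem_compl.2 hu, hyu⟩),
      (hT.nbrsIn_eq hdeg hy).2]
  have h4 := card_cliquesIn_le_one (H := H) h3
  have h5 := card_le_card (cliquesIn_mono (H := H) (m := q) (erase_subset u Sᶜ))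
  have h6 := card_cliquesIn_eq_zero (H := H) (m := p - 1) (by omega) hcl
  unfold cliqueWeight at h1
  rw [hcompl, card_cliquesIn_insert (by omega) hyU, card_cliquesIn_insert (by omega) hu', h6] at h1
  omega

/-- If moreover `u` is adjacent to all the other neighbours of `y` in `Sᶜ`, then `u` and `y` are
twins in `Sᶜ + y`, and the exchange of `y` and `u` yields an optimal set with a new token. -/
lemma IsToken.exchange {y u a b : V} (hy : y ∈ A) (hu : u ∈ nbrsIn H Sᶜ y) (hab : a ≠ b)
    (ha : H.IsClique ((nbrsIn H Sᶜ y).erase a : Finset V))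
    (hb : H.IsClique ((nbrsIn H Sᶜ y).erase b : Finset V)) (hua : u ≠ a) (hub : u ≠ b) :
    nbrsIn H Sᶜ u = (nbrsIn H Sᶜ y).erase u ∧ (nbrsIn H Sᶜ u).card + 1 = q ∧
      IsToken H p q (insert u (S.erase y)) (insert u (nbrsIn H (S.erase y) u)) := by
  obtain ⟨huS, hyu⟩ := mem_nbrsIn.1 hu
  have huS' := mem_compl.1 huS
  have hR := (hT.nbrsIn_eq hdeg hy).2
  have hE := hT.isEdgeOptimal_erase hdeg hy
  have hu' : u ∉ S.erase y := fun h => huS' (mem_of_mem_erase h)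
  have hsub : (nbrsIn H Sᶜ y).erase u ⊆ nbrsIn H Sᶜ u := fun v hv => by
    obtain ⟨hv1, hv2⟩ := mem_erase.1 hv
    exact mem_nbrsIn.2 ⟨(mem_nbrsIn.1 hv2).1,
      adj_of_isClique_erase hab ha hb hu hua hub hv2 hv1.symm⟩
  have hcR : ((nbrsIn H Sᶜ y).erase u).card + 1 = q := by rw [card_erase_add_one hu, hR]
  have hle := card_le_card hsub
  have hc := hT.card_nbrsIn_compl_erase hy hyu
  have hle' := (hE.card_nbrsIn_eq hdeg hu' (by omega)).2
  have hN : nbrsIn H Sᶜ u = (nbrsIn H Sᶜ y).erase u :=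
    (eq_of_subset_of_card_le hsub (by omega)).symm
  have hgood : (nbrsIn H Sᶜ u).card + 1 = q := by omega
  obtain ⟨hI, hd, hcl⟩ := hT.isClique_nbrsIn_erase hdeg hp hq hy hyu huS' hgood
  refine ⟨hN, hgood, ⟨hI, fun T hT' => ?_⟩, ?_, ?_, ?_⟩
  · refine le_trans ?_ (hT.optimal.2 T hT')
    have h2 := hT.card_cliquesIn_erase_add_one hdeg hp hy
    have hyU : y ∉ Sᶜ.erase u := by simp [hT.subset hy]
    have hcompl : (insert u (S.erase y))ᶜ = insert y (Sᶜ.erase u) := by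
      rw [compl_insert, compl_erase, erase_insert_of_ne hyu.ne]
    have h3 : nbrsIn H (Sᶜ.erase u) y = nbrsIn H Sᶜ u := by
      rw [hN]; ext w; simp only [mem_nbrsIn, mem_erase]; tauto
    have h4 := card_cliquesIn_le_one (H := H) (m := p - 1) (X := nbrsIn H (S.erase y) u) (by omega)
    have h5 := card_cliquesIn_erase (H := H) (m := q) (by omega) huS
    unfold cliqueWeight
    rw [hcompl, card_cliquesIn_insert (by omega) hyU, card_cliquesIn_insert (by omega) hu', h3]
    omega
  · exact insert_subset_insert _ (filter_subset _ _)
  · rw [card_insert_of_notMem (fun h => H.irrefl (mem_nbrsIn.1 h).2), hd]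
  · rw [coe_insert, SimpleGraph.isClique_insert]
    exact ⟨hcl, fun w hw _ => (mem_nbrsIn.1 hw).2⟩

end Token

/-! ### Moving tokens -/

section Chain
variable {V : Type*} [DecidableEq V] [Fintype V] {H : SimpleGraph V} [DecidableRel H.Adj] {p q : ℕ}
  {S A : Finset V} (hT : IsToken H p q S A) (hdeg : ∀ v, H.degree v + 1 ≤ p + q)
  (hp : 3 ≤ p) (hq : 3 ≤ q)
include hT hdeg hp hq

/-- A vertex of `Sᶜ` with `q - 1` neighbours in `Sᶜ` is adjacent to all of the token as soon as it
is adjacent to two of its vertices. -/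
lemma IsToken.adj_of_adj_of_adj {v z z' : V} (hv : v ∉ S) (hgood : (nbrsIn H Sᶜ v).card + 1 = q)
    (hz : z ∈ A) (hz' : z' ∈ A) (hzz : z ≠ z') (h : H.Adj v z) (h' : H.Adj v z') :
    ∀ x ∈ A, H.Adj v x := by
  obtain ⟨-, hc, hcl⟩ :=
    hT.isClique_nbrsIn_erase hdeg (by omega) (by omega) hz h.symm hv hgood
  have hz'Q : z' ∈ nbrsIn H (S.erase z) v :=
    mem_nbrsIn.2 ⟨mem_erase.2 ⟨hzz.symm, hT.subset hz'⟩, h'⟩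
  have hsub : nbrsIn H (S.erase z) v ⊆ A.erase z := fun w hw => by
    obtain ⟨hwS, -⟩ := mem_nbrsIn.1 hw
    refine mem_erase.2 ⟨(mem_erase.1 hwS).1, ?_⟩
    by_cases hwz : w = z'
    · rwa [hwz]
    · have : w ∈ nbrsIn H S z' :=
        mem_nbrsIn.2 ⟨(mem_erase.1 hwS).2, hcl hz'Q hw (Ne.symm hwz)⟩
      rw [(hT.nbrsIn_eq hdeg hz').1] at this
      exact mem_of_mem_erase this
  have heq := eq_of_subset_of_card_le hsub (by rw [card_erase_of_mem hz, hT.card]; omega)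
  intro x hx
  by_cases hxz : x = z
  · rwa [hxz]
  · have : x ∈ nbrsIn H (S.erase z) v := heq ▸ mem_erase.2 ⟨hxz, hx⟩
    exact (mem_nbrsIn.1 this).2

variable (hfree : NoAlmostClique H (p + q - 1))
include hfree

/-- A vertex of `Sᶜ` with `q - 1` neighbours in `Sᶜ` has at most one neighbour in a token. If it
had two, it would be adjacent to the whole token; the neighbourhoods in `Sᶜ` of the token vertices
then overlap so much that some of them completes the token to a clique on `p + q - 1` vertices. -/
lemma IsToken.not_adj_of_adj {u y y' : V} (hu : u ∉ S) (hgood : (nbrsIn H Sᶜ u).card + 1 = q)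
    (hy : y ∈ A) (hy' : y' ∈ A) (hyy : y ≠ y') (h : H.Adj u y) : ¬ H.Adj u y' := by
  intro h'
  have hall := hT.adj_of_adj_of_adj hdeg hp hq hu hgood hy hy' hyy h h'
  have hp2 : 2 ≤ p := by omega
  have hq2 : 2 ≤ q := by omega
  have huR : ∀ z ∈ A, u ∈ nbrsIn H Sᶜ z := fun z hz =>
    mem_nbrsIn.2 ⟨mem_compl.2 hu, (hall z hz).symm⟩
  have hcardR : ∀ z ∈ A, (nbrsIn H Sᶜ z).card = q := fun z hz =>
    (hT.nbrsIn_eq hdeg hz).2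
  have hclique : ∀ z ∈ A, ∀ a ∈ nbrsIn H Sᶜ z, H.IsClique ((nbrsIn H Sᶜ z).erase a : Finset V) →
      ¬ ∀ x ∈ A, ∀ r ∈ (nbrsIn H Sᶜ z).erase a, H.Adj x r := by
    intro z hz a ha hcl hadj
    refine hfree.not_isClique (by omega) ?_ (isClique_union hT.clique hcl hadj)
    rw [card_union_of_disjoint, hT.card, card_erase_of_mem ha, hcardR z hz]
    · omega
    · refine disjoint_left.2 fun w h1 h2 => ?_
      exact mem_compl.1 (mem_nbrsIn.1 (mem_of_mem_erase h2)).1 (hT.subset h1)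
  by_cases hex : ∃ z ∈ A, ∃ e ∈ nbrsIn H Sᶜ z, u ≠ e ∧
      H.IsClique ((nbrsIn H Sᶜ z).erase u : Finset V) ∧
      H.IsClique ((nbrsIn H Sᶜ z).erase e : Finset V)
  · obtain ⟨z, hz, e, he, hue, hcu, hce⟩ := hex
    obtain ⟨v, hv, hvu, hve, hvz⟩ : ∃ v ∈ nbrsIn H Sᶜ z, v ≠ u ∧ v ≠ e ∧
        ∀ x ∈ A, H.Adj v x → x = z := by
      by_contra hcon
      push Not at hcon
      refine hclique z hz e he hce fun x hx r hr => ?_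
      obtain ⟨hre, hr⟩ := mem_erase.1 hr
      by_cases hru : r = u
      · rw [hru]; exact (hall x hx).symm
      · obtain ⟨x', hx', hrx', hxz'⟩ := hcon r hr hru hre
        obtain ⟨-, hg, -⟩ := hT.exchange hdeg hp2 hq2 hz hr hue hcu hce hru hre
        exact (hT.adj_of_adj_of_adj hdeg hp hq (mem_compl.1 (mem_nbrsIn.1 hr).1) hg hx' hz hxz'
          hrx' (mem_nbrsIn.1 hr).2.symm x hx).symm
    obtain ⟨hNv, -, -⟩ := hT.exchange hdeg hp2 hq2 hz hv hue hcu hce hvu hve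
    have hvu' : H.Adj v u := by
      have : u ∈ nbrsIn H Sᶜ v := hNv ▸ mem_erase.2 ⟨hvu.symm, huR z hz⟩
      exact (mem_nbrsIn.1 this).2
    have key : ∀ z' ∈ A, z' ≠ z → ∃ w ∈ nbrsIn H Sᶜ u \ nbrsIn H Sᶜ z,
        (nbrsIn H Sᶜ w).card + 1 = q ∧ H.Adj w z' := by
      intro z' hz' hzz'
      have hvR : v ∉ nbrsIn H Sᶜ z' := fun hvR =>
        hzz' (hvz z' hz' (mem_nbrsIn.1 hvR).2.symm)
      obtain ⟨a, ha, b, hb, hab, hca, hcb⟩ := hT.exists_isClique_erase hdeg hp2 hq2 hz'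
      have huab : u = a ∨ u = b := by
        by_contra hcon
        push Not at hcon
        obtain ⟨hNu, -, -⟩ := hT.exchange hdeg hp2 hq2 hz' (huR z' hz') hab hca hcb hcon.1 hcon.2
        have : v ∈ nbrsIn H Sᶜ u := mem_nbrsIn.2 ⟨(mem_nbrsIn.1 hv).1, hvu'.symm⟩
        rw [hNu] at this
        exact hvR (mem_of_mem_erase this)
      obtain ⟨w, hw⟩ : (((nbrsIn H Sᶜ z').erase a).erase b).Nonempty := by
        rw [← card_pos, card_erase_of_mem (mem_erase.2 ⟨hab.symm, hb⟩), card_erase_of_mem ha,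
          hcardR z' hz']
        omega
      simp only [mem_erase] at hw
      obtain ⟨hwb, hwa, hwR⟩ := hw
      obtain ⟨hNw, hgw, -⟩ := hT.exchange hdeg hp2 hq2 hz' hwR hab hca hcb hwa hwb
      have hwu : w ≠ u := by rcases huab with rfl | rfl <;> assumption
      have hwu' : H.Adj w u := by
        have : u ∈ nbrsIn H Sᶜ w := hNw ▸ mem_erase.2 ⟨hwu.symm, huR z' hz'⟩
        exact (mem_nbrsIn.1 this).2
      have hwS := (mem_nbrsIn.1 hwR).1
      refine ⟨w, mem_sdiff.2 ⟨mem_nbrsIn.2 ⟨hwS, hwu'.symm⟩, fun hwz => ?_⟩, hgw,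
        (mem_nbrsIn.1 hwR).2.symm⟩
      have hwv : w ≠ v := fun e => hvR (e ▸ hwR)
      have h1 : w ∈ nbrsIn H Sᶜ v := hNv ▸ mem_erase.2 ⟨hwv, hwz⟩
      have h2 : v ∈ nbrsIn H Sᶜ w :=
        mem_nbrsIn.2 ⟨(mem_nbrsIn.1 hv).1, (mem_nbrsIn.1 h1).2.symm⟩
      rw [hNw] at h2
      exact hvR (mem_of_mem_erase h2)
    -- Only one neighbour of `u` in `Sᶜ` can lie outside the neighbourhood of `z`.
    have hone : (nbrsIn H Sᶜ u \ nbrsIn H Sᶜ z).card ≤ 1 := by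
      have h1 : ((nbrsIn H Sᶜ z).erase e).erase u ⊆ nbrsIn H Sᶜ u ∩ nbrsIn H Sᶜ z := by
        intro r hr
        simp only [mem_erase] at hr
        refine mem_inter.2 ⟨mem_nbrsIn.2 ⟨(mem_nbrsIn.1 hr.2.2).1, ?_⟩, hr.2.2⟩
        exact hce (by simp [hue, huR z hz]) (by simp [hr.2.1, hr.2.2]) (Ne.symm hr.1)
      have h2 := card_le_card h1
      rw [card_erase_of_mem (mem_erase.2 ⟨hue, huR z hz⟩), card_erase_of_mem he,
        hcardR z hz] at h2
      have h3 := card_sdiff_add_card_inter (nbrsIn H Sᶜ u) (nbrsIn H Sᶜ z)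
      omega
    obtain ⟨z₁, hz₁, z₂, hz₂, hzz⟩ := one_lt_card.1
      (show 1 < (A.erase z).card by rw [card_erase_of_mem hz, hT.card]; omega)
    rw [mem_erase] at hz₁ hz₂
    obtain ⟨w, hw, hgw, hwz₁⟩ := key z₁ hz₁.2 hz₁.1
    obtain ⟨w', hw', -, hwz₂⟩ := key z₂ hz₂.2 hz₂.1
    obtain rfl := card_le_one.1 hone w hw w' hw'
    obtain ⟨hw1, hw2⟩ := mem_sdiff.1 hw
    have hwS := (mem_nbrsIn.1 hw1).1
    exact hw2 (mem_nbrsIn.2 ⟨hwS, (hT.adj_of_adj_of_adj hdeg hp hq (mem_compl.1 hwS) hgw hz₁.2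
      hz₂.2 hzz hwz₁ hwz₂ z hz).symm⟩)
  · push Not at hex
    have hU : ∀ z ∈ A, nbrsIn H Sᶜ z = insert u (nbrsIn H Sᶜ u) := by
      intro z hz
      obtain ⟨a, ha, b, hb, hab, hca, hcb⟩ := hT.exists_isClique_erase hdeg hp2 hq2 hz
      have hua : u ≠ a := by rintro rfl; exact hex z hz b hb hab hca hcb
      have hub : u ≠ b := by rintro rfl; exact hex z hz a ha hab.symm hcb hca
      rw [(hT.exchange hdeg hp2 hq2 hz (huR z hz) hab hca hcb hua hub).1, insert_erase (huR z hz)]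
    obtain ⟨a, ha, b, hb, hab, hca, hcb⟩ := hT.exists_isClique_erase hdeg hp2 hq2 hy
    refine hclique y hy a ha hca fun x hx r hr => ?_
    have : r ∈ nbrsIn H Sᶜ x := by rw [hU x hx, ← hU y hy]; exact mem_of_mem_erase hr
    exact (mem_nbrsIn.1 this).2

end Chain

section Final
variable {V : Type*} [DecidableEq V] [Fintype V] {H : SimpleGraph V} [DecidableRel H.Adj] {p q : ℕ}
variable (H p q) in
/-- `F` records the remains of the tokens `A` has passed through on its way: each `B ∈ F` is a
union of components on `p - 1` vertices of the graph induced on `S`, which still has a common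
neighbour `w ∈ Sᶜ`, namely the vertex that was moved out of it. The last neighbour `t` of `w`
in `S` is the vertex `w` was exchanged with; `t` is the vertex `x` by which `A` was completed or
lies in a member of `F`. -/
structure IsTrail (S A : Finset V) (x : V) (F : Finset (Finset V)) : Prop where
  token : IsToken H p q S A
  mem : x ∈ A
  subset : ∀ B ∈ F, B ⊆ S
  disjoint : ∀ B ∈ F, Disjoint B A
  card : ∀ B ∈ F, B.card + 1 = p
  closed : ∀ B ∈ F, ∀ b ∈ B, nbrsIn H S b ⊆ B
  witness : ∀ B ∈ F, ∃ w ∉ S, (nbrsIn H Sᶜ w).card + 1 = q ∧ (∀ b ∈ B, H.Adj w b) ∧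
    ∃ t ∈ S, t ∉ B ∧ H.Adj w t ∧ (t = x ∨ ∃ B' ∈ F, t ∈ B')

variable {S A : Finset V} (hdeg : ∀ v, H.degree v + 1 ≤ p + q)
  (hp : 3 ≤ p) (hq : 3 ≤ q) (hfree : NoAlmostClique H (p + q - 1))
include hdeg hp hq hfree

/-- The token can be moved on, which adds the rest of it to the trail: exchange a vertex `y ≠ x` of
`A` with a twin `u` of `y` in `Sᶜ`. -/
lemma IsTrail.exists_insert {x : V} {F : Finset (Finset V)} (h : IsTrail H p q S A x F) :
    ∃ S' A' x' F', IsTrail H p q S' A' x' F' ∧ F.card < F'.card := by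
  have hp2 : 2 ≤ p := by omega
  have hq2 : 2 ≤ q := by omega
  have hT := h.token
  obtain ⟨y, hy⟩ : (A.erase x).Nonempty := by
    rw [← card_pos, card_erase_of_mem h.mem, hT.card]; omega
  obtain ⟨hyx, hy⟩ := mem_erase.1 hy
  have hyS := hT.subset hy
  obtain ⟨a, ha, b, hb, hab, hca, hcb⟩ := hT.exists_isClique_erase hdeg hp2 hq2 hy
  have hR := (hT.nbrsIn_eq hdeg hy).2
  obtain ⟨u, hu⟩ : (((nbrsIn H Sᶜ y).erase a).erase b).Nonempty := by
    rw [← card_pos, card_erase_of_mem (mem_erase.2 ⟨hab.symm, hb⟩), card_erase_of_mem ha, hR]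
    omega
  simp only [mem_erase] at hu
  obtain ⟨hub, hua, hu⟩ := hu
  obtain ⟨hNu, hgu, hT'⟩ := hT.exchange hdeg hp2 hq2 hy hu hab hca hcb hua hub
  obtain ⟨huS, hyu⟩ := mem_nbrsIn.1 hu
  rw [mem_compl] at huS
  have hnadj : ∀ z ∈ A, z ≠ y → ¬ H.Adj u z := fun z hz hzy =>
    hT.not_adj_of_adj hdeg hp hq hfree huS hgu hy hz (Ne.symm hzy) hyu.symm
  have hcompl : (insert u (S.erase y))ᶜ = insert y (Sᶜ.erase u) := by
    rw [compl_insert, compl_erase, erase_insert_of_ne hyu.ne]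
  -- The witnesses of the members of `F` are not adjacent to `y` or `u`.
  have hwit : ∀ B ∈ F, ∃ w ∉ insert u (S.erase y),
      (nbrsIn H (insert u (S.erase y))ᶜ w).card + 1 = q ∧ (∀ b ∈ B, H.Adj w b) ∧
      ∃ t ∈ insert u (S.erase y), t ∉ B ∧ H.Adj w t ∧ (t = x ∨ ∃ B' ∈ F, t ∈ B') := by
    intro B hB
    obtain ⟨w, hw, hgw, hwB, t, htS, htB, hwt, ht⟩ := h.witness B hB
    have hty : t ≠ y := by
      rintro rfl
      rcases ht with rfl | ⟨B', hB', ht⟩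
      · exact hyx rfl
      · exact disjoint_left.1 (h.disjoint B' hB') ht hy
    have hwy : ¬ H.Adj w y := by
      intro hwy
      have hsub : insert y (insert t B) ⊆ nbrsIn H S w := by
        intro z hz
        simp only [mem_insert] at hz
        rcases hz with rfl | rfl | hz
        · exact mem_nbrsIn.2 ⟨hyS, hwy⟩
        · exact mem_nbrsIn.2 ⟨htS, hwt⟩
        · exact mem_nbrsIn.2 ⟨h.subset B hB hz, hwB z hz⟩
      have h1 := card_le_card hsub
      have hyB : y ∉ B := fun hyB => disjoint_left.1 (h.disjoint B hB) hyB hy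
      rw [card_insert_of_notMem (by simp [hty.symm, hyB]), card_insert_of_notMem htB] at h1
      have h2 := card_nbrsIn_add_compl (H := H) S w
      have h3 := hdeg w
      have h4 := h.card B hB
      omega
    have hwu : w ≠ u := by rintro rfl; exact hwy hyu.symm
    have hwu' : ¬ H.Adj w u := by
      intro hwu'
      have : w ∈ nbrsIn H Sᶜ u := mem_nbrsIn.2 ⟨mem_compl.2 hw, hwu'.symm⟩
      rw [hNu] at this
      exact hwy (mem_nbrsIn.1 (mem_of_mem_erase this)).2.symm
    refine ⟨w, ?_, ?_, hwB, t, ?_, htB, hwt, ht⟩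
    · simp [hwu, hw]
    · rw [← hgw, hcompl]
      congr 2
      ext z
      simp only [mem_nbrsIn, mem_insert, mem_erase]
      constructor
      · rintro ⟨rfl | hz, hz'⟩
        · exact (hwy hz').elim
        · exact ⟨hz.2, hz'⟩
      · rintro ⟨hz, hz'⟩
        exact ⟨Or.inr ⟨by rintro rfl; exact hwu' hz', hz⟩, hz'⟩
    · exact mem_insert_of_mem (mem_erase.2 ⟨hty, htS⟩)
  have hcQ : (nbrsIn H (S.erase y) u).card + 1 = p := by
    have := hT'.card
    rwa [card_insert_of_notMem (fun h => H.irrefl (mem_nbrsIn.1 h).2)] at this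
  -- The new token cannot run into a member `B` of `F`, whose witness would see all of `B`.
  have hdisj : ∀ B ∈ F, Disjoint B (nbrsIn H (S.erase y) u) := by
    intro B hB
    rw [disjoint_left]
    intro b hbB hbQ
    have hsub : nbrsIn H (S.erase y) u ⊆ B := by
      intro z hz
      by_cases hzb : z = b
      · rwa [hzb]
      · refine h.closed B hB b hbB (mem_nbrsIn.2 ⟨(mem_erase.1 (mem_nbrsIn.1 hz).1).2, ?_⟩)
        exact hT'.clique (mem_insert_of_mem hbQ) (mem_insert_of_mem hz) (Ne.symm hzb)
    obtain ⟨w, hw, hgw, hwB, -⟩ := hwit B hB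
    obtain ⟨z₁, hz₁, z₂, hz₂, hzz⟩ := one_lt_card.1
      (show 1 < (nbrsIn H (S.erase y) u).card by omega)
    exact hT'.not_adj_of_adj hdeg hp hq hfree hw hgw (mem_insert_of_mem hz₁)
      (mem_insert_of_mem hz₂) hzz (hwB _ (hsub hz₁)) (hwB _ (hsub hz₂))
  have hAQ : Disjoint (A.erase y) (insert u (nbrsIn H (S.erase y) u)) := by
    rw [disjoint_left]
    intro z hz hz'
    obtain ⟨hzy, hzA⟩ := mem_erase.1 hz
    rcases mem_insert.1 hz' with rfl | hz'
    · exact huS (hT.subset hzA)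
    · exact hnadj z hzA hzy (mem_nbrsIn.1 hz').2
  have hcA : (A.erase y).card + 1 = p := by rw [card_erase_add_one hy, hT.card]
  have hAF : A.erase y ∉ F := by
    intro hAF
    obtain ⟨z, hz⟩ : (A.erase y).Nonempty := by rw [← card_pos]; omega
    exact disjoint_left.1 (h.disjoint _ hAF) hz (mem_of_mem_erase hz)
  refine ⟨insert u (S.erase y), insert u (nbrsIn H (S.erase y) u), u, insert (A.erase y) F,
    ⟨hT', mem_insert_self _ _, ?_, ?_, ?_, ?_, ?_⟩, ?_⟩
  · intro B hB
    rcases mem_insert.1 hB with rfl | hB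
    · exact (erase_subset_erase _ hT.subset).trans (subset_insert _ _)
    · intro z hz
      refine mem_insert_of_mem (mem_erase.2 ⟨?_, h.subset B hB hz⟩)
      exact fun hzy => disjoint_left.1 (h.disjoint B hB) hz (hzy ▸ hy)
  · intro B hB
    rcases mem_insert.1 hB with rfl | hB
    · exact hAQ
    · rw [disjoint_insert_right]
      exact ⟨fun huB => huS (h.subset B hB huB), hdisj B hB⟩
  · intro B hB
    rcases mem_insert.1 hB with rfl | hB
    · exact hcA
    · exact h.card B hB
  · intro B hB z hz t ht
    obtain ⟨ht, hzt⟩ := mem_nbrsIn.1 ht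
    rcases mem_insert.1 hB with rfl | hB
    · obtain ⟨hzy, hzA⟩ := mem_erase.1 hz
      rcases mem_insert.1 ht with rfl | ht
      · exact (hnadj z hzA hzy hzt.symm).elim
      · have : t ∈ nbrsIn H S z := mem_nbrsIn.2 ⟨(mem_erase.1 ht).2, hzt⟩
        rw [(hT.nbrsIn_eq hdeg hzA).1] at this
        exact mem_erase.2 ⟨(mem_erase.1 ht).1, mem_of_mem_erase this⟩
    · rcases mem_insert.1 ht with rfl | ht
      · refine (disjoint_left.1 (hdisj B hB) hz (mem_nbrsIn.2 ⟨mem_erase.2 ⟨?_, h.subset B hB hz⟩,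
          hzt.symm⟩)).elim
        exact fun hzy => disjoint_left.1 (h.disjoint B hB) hz (hzy ▸ hy)
      · exact h.closed B hB z hz (mem_nbrsIn.2 ⟨(mem_erase.1 ht).2, hzt⟩)
  · intro B hB
    rcases mem_insert.1 hB with rfl | hB
    · refine ⟨y, ?_, ?_, ?_, u, mem_insert_self _ _, ?_, hyu, Or.inl rfl⟩
      · simp [hyu.ne]
      · have : nbrsIn H (insert u (S.erase y))ᶜ y = (nbrsIn H Sᶜ y).erase u := by
          rw [hcompl, nbrsIn_insert_self]
          ext z; simp only [mem_nbrsIn, mem_erase]; tauto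
        rw [this, card_erase_add_one hu, hR]
      · intro z hz
        obtain ⟨hzy, hzA⟩ := mem_erase.1 hz
        exact hT.clique hy hzA (Ne.symm hzy)
      · exact fun hu' => huS (hT.subset (mem_of_mem_erase hu'))
    · obtain ⟨w, hw, hgw, hwB, t, htS, htB, hwt, ht⟩ := hwit B hB
      refine ⟨w, hw, hgw, hwB, t, htS, htB, hwt, Or.inr ?_⟩
      rcases ht with rfl | ⟨B', hB', ht⟩
      · exact ⟨A.erase y, mem_insert_self _ _, mem_erase.2 ⟨hyx.symm, h.mem⟩⟩
      · exact ⟨B', mem_insert_of_mem hB', ht⟩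
  · rw [card_insert_of_notMem hAF]; omega

/-- Tokens do not exist: moving one around leaves an ever growing trail. -/
lemma not_isToken : ¬ IsToken H p q S A := by
  intro hT
  have key : ∀ n : ℕ, ∃ S A x F, IsTrail H p q S A x F ∧ n ≤ F.card := by
    intro n
    induction n with
    | zero =>
      obtain ⟨x, hx⟩ : A.Nonempty := by rw [← card_pos, hT.card]; omega
      exact ⟨S, A, x, ∅, ⟨hT, hx, by simp, by simp, by simp, by simp, by simp⟩, Nat.zero_le _⟩
    | succ n ih =>
      obtain ⟨S, A, x, F, h, hn⟩ := ih
      obtain ⟨S', A', x', F', h', hlt⟩ := h.exists_insert hdeg hp hq hfree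
      exact ⟨S', A', x', F', h', by omega⟩
  obtain ⟨-, -, -, F, -, hF⟩ := key (Fintype.card (Finset V) + 1)
  have := card_le_univ F
  omega

end Final

/-! ### The case of `q` at least three -/

section ThreeLe
variable {V : Type*} [DecidableEq V] [Fintype V] {H : SimpleGraph V} [DecidableRel H.Adj] {p q : ℕ}

/-- For `p = 2` a vertex of a token together with its neighbours in `Sᶜ` is a clique on
`q + 1 = p + q - 1` vertices up to one missing edge. -/
lemma not_isToken_two {S A : Finset V} (hdeg : ∀ v, H.degree v + 1 ≤ 2 + q) (hq : 3 ≤ q)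
    (hfree : NoAlmostClique H (2 + q - 1)) : ¬ IsToken H 2 q S A := by
  intro hT
  obtain ⟨y, hy⟩ : A.Nonempty := by rw [← card_pos, hT.card]; omega
  obtain ⟨a, ha, b, hb, hab, hca, hcb⟩ := hT.exists_isClique_erase hdeg le_rfl (by omega) hy
  have hR := (hT.nbrsIn_eq hdeg hy).2
  have hyR : y ∉ nbrsIn H Sᶜ y := fun h => H.irrefl (mem_nbrsIn.1 h).2
  have key : ∀ c ∈ nbrsIn H Sᶜ y, H.IsClique ((nbrsIn H Sᶜ y).erase c : Finset V) →
      H.IsClique ((insert y (nbrsIn H Sᶜ y)).erase c : Finset V) := by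
    intro c hc hcl
    rw [erase_insert_of_ne (by rintro rfl; exact hyR hc), coe_insert, SimpleGraph.isClique_insert]
    exact ⟨hcl, fun w hw _ => (mem_nbrsIn.1 (mem_of_mem_erase hw)).2⟩
  refine hfree (insert y (nbrsIn H Sᶜ y)) ?_ a (mem_insert_of_mem ha) b (mem_insert_of_mem hb) hab
    (key a ha hca) (key b hb hcb)
  rw [card_insert_of_notMem hyR, hR]; omega

/-- An optimal set contains no `p`-clique, and then no two `q`-cliques of its complement meet: a
common vertex of the two could be moved over at no cost in edge weight. -/
lemma exists_partition_of_three_le (hdeg : ∀ v, H.degree v + 1 ≤ p + q) (hp : 2 ≤ p) (hq : 3 ≤ q)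
    (hfree : NoAlmostClique H (p + q - 1)) :
    ∃ S : Finset V, (∀ C ⊆ S, C.card = p → ¬ H.IsClique (C : Set V)) ∧
      ∀ C ⊆ Sᶜ, ∀ D ⊆ Sᶜ, C.card = q → D.card = q → H.IsClique (C : Set V) →
        H.IsClique (D : Set V) → C ≠ D → Disjoint C D := by
  have hno : ∀ S A, ¬ IsToken H p q S A := by
    intro S A
    rcases hp.eq_or_lt with rfl | hp
    · exact not_isToken_two hdeg hq hfree
    · exact not_isToken hdeg hp hq hfree
  have hzero : ∀ S, IsOptimal H p q S → (cliquesIn H p S).card = 0 := by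
    intro S hS
    rw [card_eq_zero, eq_empty_iff_forall_notMem]
    intro A hA
    obtain ⟨h1, h2, h3⟩ := mem_cliquesIn.1 hA
    exact hno S A ⟨hS, h1, h2, h3⟩
  obtain ⟨S, hS⟩ := exists_isOptimal H p q
  refine ⟨S, fun C hC hc hcl => hno S C ⟨hS, hC, hc, hcl⟩, ?_⟩
  intro C hC D hD hcC hcD hlC hlD hCD
  rw [disjoint_left]
  intro v hvC hvD
  have hvS := hC hvC
  have herase : ∀ {C : Finset V}, C ⊆ Sᶜ → C.card = q → H.IsClique (C : Set V) → v ∈ C →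
      C.erase v ∈ cliquesIn H (q - 1) (nbrsIn H Sᶜ v) := by
    intro C hC hc hcl hv
    refine mem_cliquesIn.2 ⟨fun w hw => ?_, by rw [card_erase_of_mem hv, hc],
      hcl.subset (coe_subset.2 (erase_subset _ _))⟩
    obtain ⟨hwv, hw⟩ := mem_erase.1 hw
    exact mem_nbrsIn.2 ⟨hC hw, hcl hv hw (Ne.symm hwv)⟩
  have h1 := herase hC hcC hlC hvC
  have h2 := herase hD hcD hlD hvD
  have hne : C.erase v ≠ D.erase v := fun h => hCD (by
    rw [← insert_erase hvC, h, insert_erase hvD])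
  have htwo : 1 < (cliquesIn H (q - 1) (nbrsIn H Sᶜ v)).card :=
    one_lt_card.2 ⟨_, h1, _, h2, hne⟩
  have hdegv : q ≤ (nbrsIn H Sᶜ v).card := by
    by_contra hlt
    have h3 : (nbrsIn H Sᶜ v).card = q - 1 := by
      have := card_le_card (mem_cliquesIn.1 h1).1
      rw [(mem_cliquesIn.1 h1).2.1] at this
      omega
    have := card_cliquesIn_le_one (H := H) h3
    omega
  have hvS' := mem_compl.1 hvS
  have hI := hS.1.insert hdeg hvS' hdegv
  have hd := (hS.1.card_nbrsIn_eq hdeg hvS' hdegv).1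
  have hle : cliqueWeight H p q (insert v S) ≤ cliqueWeight H p q S := by
    have h3 := card_cliquesIn_erase (H := H) (m := q) (by omega) hvS
    have h4 := card_cliquesIn_le_one (H := H) (m := p - 1) (X := nbrsIn H S v) (by omega)
    unfold cliqueWeight
    rw [compl_insert, card_cliquesIn_insert (by omega) hvS']
    omega
  have hopt : IsOptimal H p q (insert v S) := ⟨hI, fun T hT => hle.trans (hS.2 T hT)⟩
  have h3 := hS.2 _ hI
  have h4 := card_cliquesIn_erase (H := H) (m := q) (by omega) hvS
  have h5 := hzero _ hopt
  have h6 := hzero _ hS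
  unfold cliqueWeight at h3
  rw [compl_insert] at h3
  omega
end ThreeLe

/-! ### Independent transversals -/

section Transversal
variable {V ι : Type*} [DecidableEq V] [DecidableEq ι]

/-- The classes `P i`, `i ∈ I`, have an independent transversal in `G`. -/
def HasIndepTransversal (G : SimpleGraph V) (P : ι → Finset V) (I : Finset ι) : Prop :=
  ∃ f : ι → V, (∀ i ∈ I, f i ∈ P i) ∧ ∀ i ∈ I, ∀ j ∈ I, i ≠ j → ¬ G.Adj (f i) (f j)

omit [DecidableEq V] [DecidableEq ι] in
lemma HasIndepTransversal.mono {G G' : SimpleGraph V} {P : ι → Finset V} {I J : Finset ι}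
    (h : HasIndepTransversal G P I) (hG : G' ≤ G) (hJ : J ⊆ I) : HasIndepTransversal G' P J := by
  obtain ⟨f, hf, hi⟩ := h
  exact ⟨f, fun i hi => hf i (hJ hi), fun i h1 j h2 hij h3 => hi i (hJ h1) j (hJ h2) hij (hG h3)⟩

/-- If an independent transversal exists after leaving out the class `i₀`, but not otherwise, then
some subfamily of the classes containing `i₀` is dominated by few vertices. In a graph with a
minimal edge set, an edge `xz` from the class `i₀` to another class `k` is the only obstacle to some
transversal; merging the two classes and deleting the neighbours of `x` and `z` allows induction. -/
lemma exists_dominating_of_not_hasIndepTransversal [Fintype V] (n : ℕ) :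
    ∀ (I : Finset ι), I.card = n → ∀ (G : SimpleGraph V) (P : ι → Finset V) (i₀ : ι), i₀ ∈ I →
      (∀ i ∈ I, ∀ j ∈ I, ∀ v ∈ P i, v ∈ P j → i = j) →
      HasIndepTransversal G P (I.erase i₀) → ¬ HasIndepTransversal G P I →
      ∃ S ⊆ I, i₀ ∈ S ∧ ∃ X : Finset V, X.card + 2 ≤ 2 * S.card ∧
        ∀ i ∈ S, ∀ v ∈ P i, ∃ x ∈ X, G.Adj x v := by
  classical
  induction n with
  | zero => intro I hI G P i₀ hi₀; simp [card_eq_zero.1 hI] at hi₀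
  | succ n ih =>
    intro I hI G₀ P i₀ hi₀ hP hyes₀ hno₀
    obtain ⟨G, ⟨hG, hno⟩, hmin⟩ := Set.Finite.exists_minimal
      (s := {G : SimpleGraph V | G ≤ G₀ ∧ ¬ HasIndepTransversal G P I}) (Set.toFinite _)
      ⟨G₀, le_rfl, hno₀⟩
    have hyes := hyes₀.mono hG Subset.rfl
    suffices h : ∃ S ⊆ I, i₀ ∈ S ∧ ∃ X : Finset V, X.card + 2 ≤ 2 * S.card ∧
        ∀ i ∈ S, ∀ v ∈ P i, ∃ x ∈ X, G.Adj x v by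
      obtain ⟨S, hS, hi, X, hX, hd⟩ := h
      refine ⟨S, hS, hi, X, hX, fun i hi v hv => ?_⟩
      obtain ⟨x, hx, hxv⟩ := hd i hi v hv
      exact ⟨x, hx, hG hxv⟩
    rcases (P i₀).eq_empty_or_nonempty with hemp | ⟨x, hx⟩
    · exact ⟨{i₀}, by simpa using hi₀, by simp, ∅, by simp, by simp [hemp]⟩
    obtain ⟨f, hfP, hf⟩ := hyes
    -- The vertex `x` has a neighbour, as otherwise it extends the transversal `f`.
    obtain ⟨j, hj, hxj⟩ : ∃ j ∈ I.erase i₀, G.Adj x (f j) := by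
      by_contra hcon
      push Not at hcon
      refine hno ⟨Function.update f i₀ x, fun i hi => ?_, fun i hi k hk hik => ?_⟩
      · by_cases h : i = i₀
        · subst h; simpa using hx
        · simpa [h] using hfP i (mem_erase.2 ⟨h, hi⟩)
      · by_cases h : i = i₀
        · subst h
          simpa [Ne.symm hik] using hcon k (mem_erase.2 ⟨Ne.symm hik, hk⟩)
        · by_cases h' : k = i₀
          · subst h'
            simpa [h] using fun h3 => hcon i (mem_erase.2 ⟨h, hi⟩) h3.symm
          · simpa [h, h'] using hf i (mem_erase.2 ⟨h, hi⟩) k (mem_erase.2 ⟨h', hk⟩) hik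
    obtain ⟨g, hgP, hg⟩ : HasIndepTransversal (G.deleteEdges {s(x, f j)}) P I := by
      by_contra hcon
      have hle : G.deleteEdges {s(x, f j)} ≤ G := SimpleGraph.deleteEdges_le _
      have := hmin ⟨hle.trans hG, hcon⟩ hle hxj
      simp [SimpleGraph.deleteEdges_adj] at this
    set z := f j with hz
    have hg' : ∀ i ∈ I, ∀ k ∈ I, i ≠ k → G.Adj (g i) (g k) → s(g i, g k) = s(x, z) := by
      intro i hi k hk hik hadj
      by_contra hne
      exact hg i hi k hk hik (by simpa [SimpleGraph.deleteEdges_adj] using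
        ⟨hadj, by simpa using hne⟩)
    -- The transversal `g` uses both ends of the edge `xz`.
    obtain ⟨k, hk, hki, hgi, hgk⟩ : ∃ k ∈ I, k ≠ i₀ ∧ g i₀ = x ∧ g k = z := by
      have : ∃ i ∈ I, ∃ k ∈ I, i ≠ k ∧ G.Adj (g i) (g k) := by
        by_contra hcon
        push Not at hcon
        exact hno ⟨g, hgP, hcon⟩
      obtain ⟨i, hi, k, hk, hik, hadj⟩ := this
      have he := hg' i hi k hk hik hadj
      rcases Sym2.eq_iff.1 he with ⟨h1, h2⟩ | ⟨h1, h2⟩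
      · have : i = i₀ := hP i hi i₀ hi₀ (g i) (hgP i hi) (h1 ▸ hx)
        subst this
        exact ⟨k, hk, Ne.symm hik, h1, h2⟩
      · have : k = i₀ := hP k hk i₀ hi₀ (g k) (hgP k hk) (h2 ▸ hx)
        subst this
        exact ⟨i, hi, hik, h2, h1⟩
    have hzk : z ∈ P k := hgk ▸ hgP k hk
    set ok : V → Prop := fun v => ¬ G.Adj x v ∧ ¬ G.Adj z v with hok
    set P' : ι → Finset V := fun l => (if l = i₀ then P i₀ ∪ P k else P l).filter ok with hP'
    have hmemi : ∀ v, v ∈ P' i₀ ↔ (v ∈ P i₀ ∨ v ∈ P k) ∧ ok v := by simp [hP']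
    have hmem : ∀ l, l ≠ i₀ → ∀ v, v ∈ P' l ↔ v ∈ P l ∧ ok v := by
      intro l hl v; simp [hP', hl]
    clear_value P'
    have hgok : ∀ l ∈ I, l ≠ i₀ → l ≠ k → ok (g l) := by
      intro l hl hli hlk
      constructor
      · intro hadj
        rw [← hgi] at hadj
        have := hg' i₀ hi₀ l hl (Ne.symm hli) hadj
        rw [hgi, Sym2.congr_right] at this
        exact hlk (hP l hl k hk z (this ▸ hgP l hl) hzk)
      · intro hadj
        rw [← hgk] at hadj
        have := hg' k hk l hl (Ne.symm hlk) hadj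
        rw [hgk, Sym2.eq_swap, Sym2.congr_left] at this
        exact hli (hP l hl i₀ hi₀ x (this ▸ hgP l hl) hx)
    obtain ⟨S, hS, hiS, X, hX, hdom⟩ := ih (I.erase k) (by rw [card_erase_of_mem hk]; omega) G P' i₀
      (mem_erase.2 ⟨Ne.symm hki, hi₀⟩)
      (by
        intro i hi l hl v hv hv'
        obtain ⟨hik, hi⟩ := mem_erase.1 hi
        obtain ⟨hlk, hl⟩ := mem_erase.1 hl
        by_cases h : i = i₀
        · by_cases h' : l = i₀
          · rw [h, h']
          · rw [h, hmemi] at hv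
            rw [hmem l h'] at hv'
            rcases hv.1 with h3 | h3
            · rw [h]; exact hP i₀ hi₀ l hl v h3 hv'.1
            · exact (hlk (hP l hl k hk v hv'.1 h3)).elim
        · rw [hmem i h] at hv
          by_cases h' : l = i₀
          · rw [h', hmemi] at hv'
            rcases hv'.1 with h3 | h3
            · rw [h']; exact hP i hi i₀ hi₀ v hv.1 h3
            · exact (hik (hP i hi k hk v hv.1 h3)).elim
          · rw [hmem l h'] at hv'
            exact hP i hi l hl v hv.1 hv'.1)
      (by
        refine ⟨g, fun l hl => ?_, fun l hl m hm hlm hadj => ?_⟩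
        · simp only [mem_erase] at hl
          exact (hmem l hl.1 _).2 ⟨hgP l hl.2.2, hgok l hl.2.2 hl.1 hl.2.1⟩
        · simp only [mem_erase] at hl hm
          have := hg' l hl.2.2 m hm.2.2 hlm hadj
          rcases Sym2.eq_iff.1 this with ⟨h1, -⟩ | ⟨-, h1⟩
          · exact hl.1 (hP l hl.2.2 i₀ hi₀ _ (hgP l hl.2.2) (h1 ▸ hx))
          · exact hm.1 (hP m hm.2.2 i₀ hi₀ _ (hgP m hm.2.2) (h1 ▸ hx)))
      (by
        rintro ⟨h, hhP, hh⟩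
        have hhok : ∀ l ∈ I.erase k, ok (h l) := fun l hl => by
          by_cases h1 : l = i₀
          · subst h1; exact ((hmemi _).1 (hhP _ hl)).2
          · exact ((hmem l h1 _).1 (hhP l hl)).2
        have hi₀' : i₀ ∈ I.erase k := mem_erase.2 ⟨Ne.symm hki, hi₀⟩
        rcases ((hmemi _).1 (hhP i₀ hi₀')).1 with hcase | hcase
        · -- The merged class is represented in `P i₀`, so `z` represents the class `k`.
          refine hno ⟨Function.update h k z, fun l hl => ?_, fun l hl m hm hlm => ?_⟩
          · by_cases h1 : l = k
            · subst h1; simpa using hzk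
            · rw [Function.update_of_ne h1]
              by_cases h2 : l = i₀
              · rw [h2]; exact hcase
              · exact ((hmem l h2 _).1 (hhP l (mem_erase.2 ⟨h1, hl⟩))).1
          · by_cases h1 : l = k
            · subst h1
              rw [Function.update_self, Function.update_of_ne (Ne.symm hlm)]
              exact (hhok m (mem_erase.2 ⟨Ne.symm hlm, hm⟩)).2
            · rw [Function.update_of_ne h1]
              by_cases h2 : m = k
              · subst h2
                rw [Function.update_self]
                exact fun h3 => (hhok l (mem_erase.2 ⟨h1, hl⟩)).2 h3.symm
              · rw [Function.update_of_ne h2]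
                exact hh l (mem_erase.2 ⟨h1, hl⟩) m (mem_erase.2 ⟨h2, hm⟩) hlm
        · -- The merged class is represented in `P k`, so `x` represents the class `i₀`.
          obtain ⟨r, hrk, hr⟩ : ∃ r : ι → ι, r k = i₀ ∧ ∀ l, l ≠ k → r l = l :=
            ⟨fun l => if l = k then i₀ else l, by simp, fun l hl => by simp [hl]⟩
          have hrI : ∀ l ∈ I, r l ∈ I.erase k := by
            intro l hl
            by_cases h1 : l = k
            · rw [h1, hrk]; exact hi₀'
            · rw [hr l h1]; exact mem_erase.2 ⟨h1, hl⟩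
          refine hno ⟨Function.update (h ∘ r) i₀ x, fun l hl => ?_, fun l hl m hm hlm => ?_⟩
          · by_cases h1 : l = i₀
            · subst h1; simpa using hx
            · rw [Function.update_of_ne h1]
              by_cases h2 : l = k
              · rw [Function.comp_apply, h2, hrk]; exact hcase
              · rw [Function.comp_apply, hr l h2]
                exact ((hmem l h1 _).1 (hhP l (mem_erase.2 ⟨h2, hl⟩))).1
          · by_cases h1 : l = i₀
            · subst h1
              rw [Function.update_self, Function.update_of_ne (Ne.symm hlm)]
              exact (hhok _ (hrI m hm)).1
            · rw [Function.update_of_ne h1]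
              by_cases h2 : m = i₀
              · subst h2
                rw [Function.update_self]
                exact fun h3 => (hhok _ (hrI l hl)).1 h3.symm
              · rw [Function.update_of_ne h2]
                refine hh _ (hrI l hl) _ (hrI m hm) fun h3 => hlm ?_
                by_cases h4 : l = k
                · by_cases h5 : m = k
                  · rw [h4, h5]
                  · rw [h4, hrk, hr m h5] at h3
                    exact (h2 h3.symm).elim
                · by_cases h5 : m = k
                  · rw [h5, hrk, hr l h4] at h3
                    exact (h1 h3).elim
                  · rwa [hr l h4, hr m h5] at h3)
    have hkS : k ∉ S := fun h => (mem_erase.1 (hS h)).1 rfl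
    refine ⟨insert k S, insert_subset hk (hS.trans (erase_subset _ _)), mem_insert_of_mem hiS,
      insert x (insert z X), ?_, ?_⟩
    · have h1 := card_insert_le x (insert z X)
      have h2 := card_insert_le z X
      rw [card_insert_of_notMem hkS]
      omega
    · intro i hi v hv
      by_cases hv1 : G.Adj x v
      · exact ⟨x, by simp, hv1⟩
      by_cases hv2 : G.Adj z v
      · exact ⟨z, by simp, hv2⟩
      have : ∃ l ∈ S, v ∈ P' l := by
        rcases mem_insert.1 hi with rfl | hi
        · exact ⟨i₀, hiS, (hmemi v).2 ⟨Or.inr hv, hv1, hv2⟩⟩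
        · by_cases h : i = i₀
          · exact ⟨i₀, hiS, (hmemi v).2 ⟨Or.inl (h ▸ hv), hv1, hv2⟩⟩
          · exact ⟨i, hi, (hmem i h v).2 ⟨hv, hv1, hv2⟩⟩
      obtain ⟨l, hl, hvl⟩ := this
      obtain ⟨w, hw, hwv⟩ := hdom l hl v hvl
      exact ⟨w, by simp [hw], hwv⟩

/-- **Haxell's theorem**: disjoint classes of size at least `2 * d` in a graph of maximum degree at
most `d` have an independent transversal. -/
theorem hasIndepTransversal_of_two_mul_le_card [Fintype V] [Nonempty V] {G : SimpleGraph V}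
    [DecidableRel G.Adj] {d : ℕ} (hd : 0 < d) (hdeg : ∀ v, G.degree v ≤ d) {P : ι → Finset V}
    {I : Finset ι} (hP : ∀ i ∈ I, ∀ j ∈ I, ∀ v ∈ P i, v ∈ P j → i = j)
    (hcard : ∀ i ∈ I, 2 * d ≤ (P i).card) : HasIndepTransversal G P I := by
  induction I using Finset.induction_on with
  | empty => exact ⟨fun _ => Classical.arbitrary V, by simp, by simp⟩
  | insert i₀ I hi₀ ih =>
    have hyes := ih (fun i hi j hj => hP i (mem_insert_of_mem hi) j (mem_insert_of_mem hj))
      (fun i hi => hcard i (mem_insert_of_mem hi))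
    by_contra hno
    obtain ⟨S, hS, -, X, hX, hdom⟩ := exists_dominating_of_not_hasIndepTransversal _ _ rfl G P i₀
      (mem_insert_self i₀ I) hP (by rwa [erase_insert hi₀]) hno
    have h1 : S.card * (2 * d) ≤ (S.biUnion P).card := by
      rw [card_biUnion]
      · exact card_nsmul_le_sum _ _ _ fun i hi => hcard i (hS hi)
      · exact fun i hi j hj hij => disjoint_left.2 fun v hv hv' =>
          hij (hP i (hS hi) j (hS hj) v hv hv')
    have h2 : S.biUnion P ⊆ X.biUnion fun x => G.neighborFinset x := by
      intro v hv
      obtain ⟨i, hi, hv⟩ := mem_biUnion.1 hv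
      obtain ⟨x, hx, hxv⟩ := hdom i hi v hv
      exact mem_biUnion.2 ⟨x, hx, by simpa using hxv⟩
    have h3 : (X.biUnion fun x => G.neighborFinset x).card ≤ X.card * d :=
      card_biUnion_le_card_mul _ _ _ fun x _ => by simpa using hdeg x
    have h4 := card_le_card h2
    nlinarith

end Transversal

/-! ### The case of `q` equal to two -/

section LargeCliques
variable {V : Type*} [DecidableEq V] [Fintype V] {H : SimpleGraph V} [DecidableRel H.Adj] {p : ℕ}
  (hp : 4 ≤ p) (hdeg : ∀ v, H.degree v ≤ p + 1) (hfree : NoAlmostClique H (p + 1))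

variable (H p) in
/-- The vertices lying in at least two `p`-cliques. -/
def sharedVertices : Set V :=
  {x | ∃ K L : Finset V, H.IsNClique p K ∧ H.IsNClique p L ∧ K ≠ L ∧ x ∈ K ∧ x ∈ L}

include hp hdeg hfree

/-- Two `p`-cliques through `x` share exactly `p - 2` vertices: fewer is impossible by the degree
of `x`, and `p - 1` would give a clique on `p + 1` vertices up to one missing edge. Together they
exhaust the neighbourhood of `x`. -/
lemma card_inter_of_isNClique {K L : Finset V} (hK : H.IsNClique p K) (hL : H.IsNClique p L)
    (hKL : K ≠ L) {x : V} (hxK : x ∈ K) (hxL : x ∈ L) :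
    (K ∩ L).card + 2 = p ∧ ∀ w, H.Adj x w → w ∈ K ∨ w ∈ L := by
  have hsub : K ∪ L ⊆ insert x (H.neighborFinset x) := by
    intro w hw
    by_cases hwx : w = x
    · simp [hwx]
    · refine mem_insert_of_mem ?_
      rw [SimpleGraph.mem_neighborFinset]
      rcases mem_union.1 hw with h | h
      · exact hK.isClique hxK h (Ne.symm hwx)
      · exact hL.isClique hxL h (Ne.symm hwx)
  have h1 := card_union_add_card_inter K L
  rw [hK.card_eq, hL.card_eq] at h1
  have h2 : (insert x (H.neighborFinset x)).card ≤ p + 2 := by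
    have := hdeg x
    rw [card_insert_of_notMem (by simp), H.card_neighborFinset_eq_degree]
    omega
  have h3 := card_le_card hsub
  have h4 : (K \ L).Nonempty := by
    rw [sdiff_nonempty]
    exact fun h => hKL (eq_of_subset_of_card_le h (by rw [hK.card_eq, hL.card_eq]))
  have h5 := card_sdiff_add_card_inter K L
  rw [hK.card_eq] at h5
  have h6 := h4.card_pos
  have h7 : (K ∩ L).card + 1 ≠ p := by
    intro h7
    obtain ⟨a, ha⟩ := h4
    have h8 := card_sdiff_add_card_inter L K
    rw [hL.card_eq, inter_comm] at h8
    obtain ⟨b, hb⟩ : (L \ K).Nonempty := by rw [← card_pos]; omega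
    rw [mem_sdiff] at ha hb
    have ha' : (K ∪ L).erase a = L := by
      symm
      refine eq_of_subset_of_card_le (fun w hw => mem_erase.2 ⟨?_, mem_union_right _ hw⟩) ?_
      · rintro rfl; exact ha.2 hw
      · rw [card_erase_of_mem (mem_union_left _ ha.1), hL.card_eq]; omega
    have hb' : (K ∪ L).erase b = K := by
      symm
      refine eq_of_subset_of_card_le (fun w hw => mem_erase.2 ⟨?_, mem_union_left _ hw⟩) ?_
      · rintro rfl; exact hb.2 hw
      · rw [card_erase_of_mem (mem_union_right _ hb.1), hK.card_eq]; omega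
    refine hfree (K ∪ L) (by omega) a (mem_union_left _ ha.1) b (mem_union_right _ hb.1) ?_ ?_ ?_
    · rintro rfl; exact ha.2 hb.1
    · rw [ha']; exact hL.isClique
    · rw [hb']; exact hK.isClique
  refine ⟨by omega, fun w hw => ?_⟩
  have h8 := eq_of_subset_of_card_le hsub (by omega)
  have : w ∈ K ∪ L := by rw [h8]; simp [hw]
  exact mem_union.1 this

/-- No vertex lies in three `p`-cliques. -/
lemma eq_or_eq_of_isNClique {K L M : Finset V} (hK : H.IsNClique p K) (hL : H.IsNClique p L)
    (hM : H.IsNClique p M) (hKL : K ≠ L) {x : V} (hxK : x ∈ K) (hxL : x ∈ L) (hxM : x ∈ M) :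
    M = K ∨ M = L := by
  by_contra hcon
  push Not at hcon
  have key : ∀ {K L : Finset V}, H.IsNClique p K → H.IsNClique p L → K ≠ L → M ≠ K → x ∈ K →
      x ∈ L → L \ K ⊆ M := by
    intro K L hK hL hKL hMK hxK hxL
    obtain ⟨h1, h2⟩ := card_inter_of_isNClique hp hdeg hfree hK hL hKL hxK hxL
    obtain ⟨h3, -⟩ := card_inter_of_isNClique hp hdeg hfree hM hK hMK hxM hxK
    have h4 : M \ K ⊆ L \ K := by
      intro w hw
      obtain ⟨hwM, hwK⟩ := mem_sdiff.1 hw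
      have hxw : x ≠ w := by rintro rfl; exact hwK hxK
      exact mem_sdiff.2 ⟨(h2 w (hM.isClique hxM hwM hxw)).resolve_left hwK, hwK⟩
    have h5 := card_sdiff_add_card_inter M K
    have h6 := card_sdiff_add_card_inter L K
    rw [hM.card_eq] at h5
    rw [hL.card_eq, inter_comm] at h6
    rw [← eq_of_subset_of_card_le h4 (by omega)]
    exact sdiff_subset
  have h1 := key hK hL hKL hcon.1 hxK hxL
  have h2 := key hL hK hKL.symm hcon.2 hxL hxK
  obtain ⟨a, ha⟩ : (K \ L).Nonempty := by
    rw [sdiff_nonempty]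
    exact fun h => hKL (eq_of_subset_of_card_le h (by rw [hK.card_eq, hL.card_eq]))
  obtain ⟨haK, haL⟩ := mem_sdiff.1 ha
  refine hfree.not_isClique (by omega) (D := insert a L)
    (by rw [card_insert_of_notMem haL, hL.card_eq]) ?_
  rw [coe_insert, SimpleGraph.isClique_insert]
  refine ⟨hL.isClique, fun c hc hac => ?_⟩
  by_cases hcK : c ∈ K
  · exact hK.isClique haK hcK hac
  · exact hM.isClique (h2 ha) (h1 (mem_sdiff.2 ⟨hc, hcK⟩)) hac

/-- An inclusion-minimal set of shared vertices that meets every `p`-clique containing a shared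
vertex induces a graph of maximum degree at most one. -/
lemma exists_hitting_sharedVertices :
    ∃ S : Finset V, (S : Set V) ⊆ sharedVertices H p ∧
      (∀ K, H.IsNClique p K → (∃ x ∈ K, x ∈ sharedVertices H p) → ∃ s ∈ K, s ∈ S) ∧
      ∀ s ∈ S, ∀ a ∈ S, ∀ b ∈ S, H.Adj s a → H.Adj s b → a = b := by
  classical
  obtain ⟨S, ⟨hSX, hhit⟩, hmin⟩ := Set.Finite.exists_minimal
    (s := {S : Finset V | (S : Set V) ⊆ sharedVertices H p ∧
      ∀ K, H.IsNClique p K → (∃ x ∈ K, x ∈ sharedVertices H p) → ∃ s ∈ K, s ∈ S}) (Set.toFinite _)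
    ⟨univ.filter (· ∈ sharedVertices H p), by simp, by simp⟩
  refine ⟨S, hSX, hhit, fun s hs a ha b hb hsa hsb => ?_⟩
  -- By minimality each `s ∈ S` is the only element of `S` in some `p`-clique.
  have hpriv : ∀ s ∈ S, ∃ K, H.IsNClique p K ∧ s ∈ K ∧ ∀ t ∈ K, t ∈ S → t = s := by
    intro s hs
    by_contra hcon
    push Not at hcon
    have : S ≤ S.erase s := hmin ⟨fun x hx => hSX (mem_of_mem_erase hx), fun K hK hx => by
      obtain ⟨t, htK, htS⟩ := hhit K hK hx
      by_cases hts : t = s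
      · obtain ⟨t', h1, h2, h3⟩ := hcon K hK (hts ▸ htK)
        exact ⟨t', h1, mem_erase.2 ⟨h3, h2⟩⟩
      · exact ⟨t, htK, mem_erase.2 ⟨hts, htS⟩⟩⟩ (erase_subset _ _)
    exact notMem_erase s S (this hs)
  by_contra hab
  obtain ⟨K, hK, hsK, hKS⟩ := hpriv s hs
  obtain ⟨L, hL, hsL, hKL⟩ : ∃ L, H.IsNClique p L ∧ s ∈ L ∧ K ≠ L := by
    obtain ⟨K₁, K₂, h1, h2, h12, hs1, hs2⟩ := hSX hs
    by_cases h : K = K₁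
    · exact ⟨K₂, h2, hs2, h ▸ h12⟩
    · exact ⟨K₁, h1, hs1, h⟩
  obtain ⟨hc, hN⟩ := card_inter_of_isNClique hp hdeg hfree hK hL hKL hsK hsL
  have hmemL : ∀ t ∈ S, H.Adj s t → t ∈ L \ K := by
    intro t ht hst
    have htK : t ∉ K := fun htK => hst.ne (hKS t htK ht).symm
    exact mem_sdiff.2 ⟨(hN t hst).resolve_left htK, htK⟩
  have haL := hmemL a ha hsa
  have hbL := hmemL b hb hsb
  have hLK : ({a, b} : Finset V) = L \ K := by
    refine eq_of_subset_of_card_le (insert_subset haL (singleton_subset_iff.2 hbL)) ?_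
    have h1 := card_sdiff_add_card_inter L K
    rw [hL.card_eq, inter_comm] at h1
    rw [card_pair hab]
    omega
  obtain ⟨M, hM, haM, hMS⟩ := hpriv a ha
  have hML : M ≠ L := by
    rintro rfl
    exact hsa.ne (hMS s hsL hs)
  obtain ⟨hc', -⟩ :=
    card_inter_of_isNClique hp hdeg hfree hM hL hML haM (mem_sdiff.1 haL).1
  have hsub : M ∩ L ⊆ {a, b} := by
    rw [hLK]
    intro w hw
    obtain ⟨hwM, hwL⟩ := mem_inter.1 hw
    refine mem_sdiff.2 ⟨hwL, fun hwK => ?_⟩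
    rcases eq_or_eq_of_isNClique hp hdeg hfree hK hL hM hKL hwK hwL hwM with h | h
    · exact (mem_sdiff.1 haL).2 (h ▸ haM)
    · exact hML h
  have heq := eq_of_subset_of_card_le hsub (by rw [card_pair hab]; omega)
  have hbM : b ∈ M ∩ L := by rw [heq]; simp
  exact hab (hMS b (mem_inter.1 hbM).1 hb).symm

omit hfree in
/-- The `p`-cliques without shared vertices are disjoint and send at most two edges from each vertex
to the outside, so they have an independent transversal. -/
lemma exists_independent_hitting [Nonempty V] :
    ∃ f : Finset V → V, (∀ K, H.IsNClique p K → (∀ x ∈ K, x ∉ sharedVertices H p) → f K ∈ K) ∧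
      ∀ K L, H.IsNClique p K → H.IsNClique p L → (∀ x ∈ K, x ∉ sharedVertices H p) →
        (∀ x ∈ L, x ∉ sharedVertices H p) → ¬ H.Adj (f K) (f L) := by
  classical
  set I : Finset (Finset V) := univ.filter fun K =>
    H.IsNClique p K ∧ ∀ x ∈ K, x ∉ sharedVertices H p with hI
  have hmem : ∀ K, K ∈ I ↔ H.IsNClique p K ∧ ∀ x ∈ K, x ∉ sharedVertices H p := by simp [hI]
  have hdisj : ∀ K ∈ I, ∀ L ∈ I, ∀ v ∈ K, v ∈ L → K = L := by
    intro K hK L hL v hvK hvL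
    by_contra hne
    rw [hmem] at hK hL
    exact hK.2 v hvK ⟨K, L, hK.1, hL.1, hne, hvK, hvL⟩
  let G : SimpleGraph V :=
    { Adj := fun u v => H.Adj u v ∧ (∃ K ∈ I, u ∈ K ∧ v ∉ K) ∧ ∃ K ∈ I, v ∈ K ∧ u ∉ K
      symm := ⟨fun u v h => ⟨h.1.symm, h.2.2, h.2.1⟩⟩
      loopless := ⟨fun u h => H.irrefl h.1⟩ }
  have hG : ∀ v, G.degree v ≤ 2 := by
    intro v
    by_cases hv : ∃ K ∈ I, v ∈ K
    · obtain ⟨K, hK, hvK⟩ := hv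
      have hKc := ((hmem K).1 hK).1
      have hsub : G.neighborFinset v ⊆ H.neighborFinset v \ K.erase v := by
        intro w hw
        rw [SimpleGraph.mem_neighborFinset] at hw
        obtain ⟨hvw, ⟨L, hL, hvL, hwL⟩, -⟩ := hw
        rw [← hdisj K hK L hL v hvK hvL] at hwL
        simp [hvw, hwL]
      have hsub' : K.erase v ⊆ H.neighborFinset v := by
        intro w hw
        obtain ⟨hwv, hw⟩ := mem_erase.1 hw
        simpa using hKc.isClique hvK hw (Ne.symm hwv)
      have h1 := card_le_card hsub
      rw [card_sdiff_of_subset hsub', card_erase_of_mem hvK, hKc.card_eq,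
        H.card_neighborFinset_eq_degree, G.card_neighborFinset_eq_degree] at h1
      have := hdeg v
      omega
    · have : G.neighborFinset v = ∅ := by
        rw [eq_empty_iff_forall_notMem]
        intro w hw
        rw [SimpleGraph.mem_neighborFinset] at hw
        obtain ⟨-, ⟨L, hL, hvL, -⟩, -⟩ := hw
        exact hv ⟨L, hL, hvL⟩
      rw [← G.card_neighborFinset_eq_degree, this, card_empty]
      omega
  obtain ⟨f, hf, hindep⟩ := hasIndepTransversal_of_two_mul_le_card (P := fun K : Finset V => K)
    two_pos hG hdisj (fun K hK => by rw [((hmem K).1 hK).1.card_eq]; omega)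
  refine ⟨f, fun K h1 h2 => hf K ((hmem K).2 ⟨h1, h2⟩), fun K L hK hL hKX hLX hadj => ?_⟩
  have hKI := (hmem K).2 ⟨hK, hKX⟩
  have hLI := (hmem L).2 ⟨hL, hLX⟩
  by_cases hKL : K = L
  · subst hKL; exact H.irrefl hadj
  · exact hindep K hKI L hLI hKL ⟨hadj, ⟨K, hKI, hf K hKI, fun h =>
      hKL (hdisj K hKI L hLI _ h (hf L hLI))⟩, L, hLI, hf L hLI, fun h =>
      hKL (hdisj K hKI L hLI _ (hf K hKI) h)⟩

/-- The complement of `S` consists of a set meeting the `p`-cliques with shared vertices and a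
transversal of the others. No edge joins the two, because the neighbours of a shared vertex lie in
the two `p`-cliques containing it. -/
lemma exists_partition_two [Nonempty V] :
    ∃ S : Finset V, (∀ C ⊆ S, C.card = p → ¬ H.IsClique (C : Set V)) ∧
      ∀ C ⊆ Sᶜ, ∀ D ⊆ Sᶜ, C.card = 2 → D.card = 2 → H.IsClique (C : Set V) →
        H.IsClique (D : Set V) → C ≠ D → Disjoint C D := by
  classical
  obtain ⟨S, hSX, hhit, hS⟩ := exists_hitting_sharedVertices hp hdeg hfree
  obtain ⟨f, hf, hindep⟩ := exists_independent_hitting hp hdeg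
  set T : Finset V := (univ.filter fun K : Finset V =>
    H.IsNClique p K ∧ ∀ x ∈ K, x ∉ sharedVertices H p).image f with hT
  have hmemT : ∀ v, v ∈ T ↔ ∃ K, (H.IsNClique p K ∧ ∀ x ∈ K, x ∉ sharedVertices H p) ∧ f K = v := by
    simp [hT]
  have hST : ∀ s ∈ S, ∀ t ∈ T, ¬ H.Adj s t := by
    intro s hs t ht hst
    obtain ⟨K, ⟨hK, hKX⟩, rfl⟩ := (hmemT t).1 ht
    obtain ⟨K₁, K₂, h1, h2, h12, hs1, hs2⟩ := hSX hs
    have hfK := hf K hK hKX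
    rcases (card_inter_of_isNClique hp hdeg hfree h1 h2 h12 hs1 hs2).2 _ hst with h | h
    · exact hKX _ hfK ⟨K, K₁, hK, h1, fun e => hKX s (e ▸ hs1) (hSX hs), hfK, h⟩
    · exact hKX _ hfK ⟨K, K₂, hK, h2, fun e => hKX s (e ▸ hs2) (hSX hs), hfK, h⟩
  have hTT : ∀ s ∈ T, ∀ t ∈ T, ¬ H.Adj s t := by
    intro s hs t ht
    obtain ⟨K, ⟨hK, hKX⟩, rfl⟩ := (hmemT s).1 hs
    obtain ⟨L, ⟨hL, hLX⟩, rfl⟩ := (hmemT t).1 ht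
    exact hindep K L hK hL hKX hLX
  have huniq : ∀ v ∈ S ∪ T, ∀ a ∈ S ∪ T, ∀ b ∈ S ∪ T, H.Adj v a → H.Adj v b → a = b := by
    intro v hv a ha b hb hva hvb
    rw [mem_union] at hv ha hb
    rcases hv with hv | hv
    · exact hS v hv a (ha.resolve_right fun h => hST v hv a h hva) b
        (hb.resolve_right fun h => hST v hv b h hvb) hva hvb
    · rcases ha with ha | ha
      · exact (hST a ha v hv hva.symm).elim
      · exact (hTT v hv a ha hva).elim
  refine ⟨(S ∪ T)ᶜ, ?_, ?_⟩
  · intro C hC hcard hcl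
    have hCn : H.IsNClique p C := ⟨hcl, hcard⟩
    obtain ⟨v, hvC, hv⟩ : ∃ v ∈ C, v ∈ S ∪ T := by
      by_cases hx : ∃ x ∈ C, x ∈ sharedVertices H p
      · obtain ⟨s, hsC, hs⟩ := hhit C hCn hx
        exact ⟨s, hsC, mem_union_left _ hs⟩
      · push Not at hx
        exact ⟨f C, hf C hCn hx, mem_union_right _ ((hmemT _).2 ⟨C, ⟨hCn, hx⟩, rfl⟩)⟩
    exact mem_compl.1 (hC hvC) hv
  · rw [compl_compl]
    intro C hC D hD hcC hcD hlC hlD hCD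
    rw [disjoint_left]
    intro v hvC hvD
    have key : ∀ {C : Finset V}, C ⊆ S ∪ T → C.card = 2 → H.IsClique (C : Set V) → v ∈ C →
        ∃ a ∈ S ∪ T, H.Adj v a ∧ C = {v, a} := by
      intro C hC hc hl hv
      obtain ⟨a, ha⟩ := card_eq_one.1 (show (C.erase v).card = 1 by
        rw [card_erase_of_mem hv, hc])
      have haC : a ∈ C.erase v := by simp [ha]
      obtain ⟨hav, haC⟩ := mem_erase.1 haC
      exact ⟨a, hC haC, hl hv haC (Ne.symm hav), by rw [← ha, insert_erase hv]⟩
    obtain ⟨a, ha, hva, rfl⟩ := key hC hcC hlC hvC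
    obtain ⟨b, hb, hvb, rfl⟩ := key hD hcD hlD hvD
    exact hCD (by rw [huniq v (hC hvC) a ha b hb hva hvb])

end LargeCliques

/-! ### Copies of complete graphs minus an edge, and induced subgraphs -/

section Translation
variable {V : Type*} [DecidableEq V] {H : SimpleGraph V}

lemma noAlmostClique_of_completeMinusEdgeFree {n : ℕ} (hn : 2 ≤ n)
    (h : CompleteMinusEdgeFree n H) : NoAlmostClique H n := by
  intro D hD a ha b hb hab hca hcb
  let i : Fin n := ⟨0, by omega⟩
  let j : Fin n := ⟨1, by omega⟩
  have hij : i ≠ j := by simp [i, j]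
  -- An enumeration of `D` that begins with `a` and `b`.
  obtain ⟨e, hei, hej⟩ : ∃ e : Fin n ≃ D, e i = ⟨a, ha⟩ ∧ e j = ⟨b, hb⟩ := by
    let e₀ : Fin n ≃ D := (Fintype.equivFinOfCardEq (by simp [hD])).symm
    let e₁ := e₀.trans (Equiv.swap (e₀ i) ⟨a, ha⟩)
    have h1 : e₁ i = ⟨a, ha⟩ := by simp [e₁]
    refine ⟨e₁.trans (Equiv.swap (e₁ j) ⟨b, hb⟩), ?_, by simp⟩
    rw [Equiv.trans_apply, h1]
    refine Equiv.swap_apply_of_ne_of_ne ?_ ?_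
    · rw [← h1]; exact fun h => hij (e₁.injective h)
    · simpa using hab
  refine h s(i, j) (by simpa using hij) ⟨⟨⟨fun k => (e k : V), ?_⟩, ?_⟩⟩
  · intro k l hkl
    obtain ⟨hne, hkl⟩ : k ≠ l ∧ s(k, l) ≠ s(i, j) := by
      simpa [SimpleGraph.deleteEdges_adj] using hkl
    have hne' : (e k : V) ≠ e l := fun h => hne (e.injective (Subtype.ext h))
    have hval : ∀ m, m ≠ i → (e m : V) ≠ a := fun m hm h' =>
      hm (e.injective (by rw [hei]; exact Subtype.ext h'))
    have hval' : ∀ m, m ≠ j → (e m : V) ≠ b := fun m hm h' =>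
      hm (e.injective (by rw [hej]; exact Subtype.ext h'))
    by_cases hia : k = i ∨ l = i
    · have : k ≠ j ∧ l ≠ j := by
        rcases hia with rfl | rfl
        · exact ⟨hij, by rintro rfl; exact hkl rfl⟩
        · exact ⟨by rintro rfl; exact hkl Sym2.eq_swap, hij⟩
      exact hcb (by simp [hval' k this.1]) (by simp [hval' l this.2]) hne'
    · push Not at hia
      exact hca (by simp [hval k hia.1]) (by simp [hval l hia.2]) hne'
  · intro k l hkl
    exact e.injective (Subtype.ext hkl)

omit [DecidableEq V] in
lemma isNClique_map_of_induce {X : Set V} {n : ℕ} {s : Finset X}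
    (hs : (H.induce X).IsNClique n s) :
    H.IsNClique n (s.map (Function.Embedding.subtype _)) := by
  refine ⟨?_, by rw [card_map, hs.card_eq]⟩
  intro u hu v hv huv
  simp only [coe_map, Set.mem_image, mem_coe] at hu hv
  obtain ⟨u, hu, rfl⟩ := hu
  obtain ⟨v, hv, rfl⟩ := hv
  exact hs.isClique hu hv fun h => huv (by rw [h])

end Translation

theorem mainTheorem3 {V : Type*} [Fintype V] (H : SimpleGraph V) [DecidableRel H.Adj]
    (hconn : H.Connected) (hΔ : 5 ≤ H.maxDegree)
    (hfree : CompleteMinusEdgeFree H.maxDegree H)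
    (p q : ℕ) (hp : 2 ≤ p) (hq : 2 ≤ q) (hpq : H.maxDegree + 1 = p + q) :
    ∃ V₁ V₂ : Set V, V₁ ∪ V₂ = Set.univ ∧ Disjoint V₁ V₂ ∧
      (H.induce V₁).CliqueFree p ∧
      ((H.induce V₂).CliqueFree q ∨ DisjointCliques q (H.induce V₂)) := by
  classical
  have hfree' := noAlmostClique_of_completeMinusEdgeFree (by omega) hfree
  have hdeg := H.degree_le_maxDegree
  obtain ⟨S, hS₁, hS₂⟩ : ∃ S : Finset V, (∀ C ⊆ S, C.card = p → ¬ H.IsClique (C : Set V)) ∧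
      ∀ C ⊆ Sᶜ, ∀ D ⊆ Sᶜ, C.card = q → D.card = q → H.IsClique (C : Set V) →
        H.IsClique (D : Set V) → C ≠ D → Disjoint C D := by
    rcases hq.eq_or_lt with rfl | hq
    · have := hconn.nonempty
      refine exists_partition_two (by omega) (fun v => (hdeg v).trans (by omega)) ?_
      rwa [show p + 1 = H.maxDegree by omega]
    · refine exists_partition_of_three_le (fun v => ?_) hp hq ?_
      · have := hdeg v
        omega
      · rwa [show p + q - 1 = H.maxDegree by omega]
  refine ⟨S, (S : Set V)ᶜ, Set.union_compl_self _, disjoint_compl_right, ?_, Or.inr ?_⟩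
  · intro C hC
    have := isNClique_map_of_induce hC
    refine hS₁ _ (fun v hv => ?_) this.card_eq this.isClique
    obtain ⟨w, -, rfl⟩ := mem_map.1 hv
    exact w.2
  · intro C D hC hD hCD
    have h1 := isNClique_map_of_induce hC
    have h2 := isNClique_map_of_induce hD
    have hsub : ∀ E : Finset ((S : Set V)ᶜ : Set V),
        E.map (Function.Embedding.subtype _) ⊆ Sᶜ := by
      intro E v hv
      obtain ⟨w, -, rfl⟩ := mem_map.1 hv
      exact mem_compl.2 w.2
    have := hS₂ _ (hsub C) _ (hsub D) h1.card_eq h2.card_eq h1.isClique h2.isClique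
      fun h => hCD (map_injective _ h)
    exact (disjoint_map _).1 this
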